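/- Let $G$ be an abelian group, let $t\geq 1$ be an integer, and let $A,B\subseteq G$ be finite subsets with $|A|,|B|\geq t$. For $i\geq 1$ and finite $X,Y\subseteq G$, let $X+_iY$ denote the set of all $g\in G$ having at least $i$ representations $g=x+y$ with $x\in X$ and $y\in Y$. Then either $$\sum_{i=1}^{t}|A+_iB|\;\geq\; t|A|+t|B|-2t^2+1,$$ or else there exist $A'\subseteq A$ and $B'\subseteq B$ such that $$l:=|A\setminus A'|+|B\setminus B'|\leq t-1,\qquad A'+_tB'=A'+B'=A+_tB,$$ the stabilizer $H:=\{x\in G : x+(A+_tB)=A+_tB\}$ is finite and nontrivial, and $$\sum_{i=1}^{t}|A+_iB|\;\geq\; t|A|+t|B|-(t-l)(|H|-\rho)-tl\;\geq\; t|A|+t|B|-t|H|,$$ where $\rho:=(|A'+H|-|A'|)+(|B'+H|-|B'|)$. -/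

import Mathlib

open scoped Pointwise

/-- The set of `i`-representable sums of `A` and `B`, for `1 ≤ i`: the elements `g` having at least
`i` representations `g = a + b` with `a ∈ A` and `b ∈ B`. (Restricting to `g ∈ A + B` is no loss
when `1 ≤ i`, see `mem_repSums` below.) -/
def repSums {G : Type*} [AddCommGroup G] [DecidableEq G] (A B : Finset G) (i : ℕ) : Finset G :=
  (A + B).filter (fun g => i ≤ A.addConvolution B g)

theorem mem_repSums {G : Type*} [AddCommGroup G] [DecidableEq G] (A B : Finset G) {i : ℕ}
    (hi : 1 ≤ i) (g : G) : g ∈ repSums A B i ↔ i ≤ A.addConvolution B g := by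
  unfold repSums
  rw [Finset.mem_filter, and_iff_right_iff_imp]
  intro h
  have hpos : 0 < ((A ×ˢ B).filter (fun ab : G × G => ab.1 + ab.2 = g)).card :=
    lt_of_lt_of_le hi h
  obtain ⟨ab, hab⟩ := Finset.card_pos.mp hpos
  simp only [Finset.mem_filter, Finset.mem_product] at hab
  rw [← hab.2]
  exact Finset.add_mem_add hab.1.1 hab.1.2

/-- The number `|A + H| - |A|` of `H`-holes of `A`, where `H` is a finite subgroup. -/
noncomputable def holeCount {G : Type*} [AddCommGroup G] (H : AddSubgroup G) (A : Finset G) : ℤ :=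
  (((A : Set G) + (H : Set G)).ncard : ℤ) - (A.card : ℤ)

/-! Counting each g with weight min(t, number of representations) turns the sum of the |A +_i B|
into N = `truncSum t A B ∅`, so assume N ≤ t(|A|+|B|) − 2t². It suffices to find a popular core: A₀
⊆ A and B₀ ⊆ B missing fewer than 2t elements in total, all of whose sums have at least t
representations. `exists_structured` enlarges A₀, B₀ to A', B' without changing D = A₀ + B₀. With H
the stabilizer of D, each element still left out has at least |H| − ρ sums off D. This count and
Kneser's theorem for (A', B') force l < t and |H| ≥ 2t + ρ, and they also give the asserted lower
bound.

The core is found by induction on |B|, for all t at once. If every translate of B that meets A lies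
in A, the whole pair is a core. Otherwise translate so that C = A ∩ B is nonempty and proper in B,
and put U = A ∪ B. Representations split between (U, C) and (A \ C, B \ C) by `rep_union_inter`. If
|C| < t, the first part is never truncated, and induction on the second with t − |C| yields a core.
If |C| ≥ t, induction on (U, C) with the same t yields a periodic set D of popular sums, but A + B
may have sums off D.

The descent deals with these. Its state is a subgroup K, a K-periodic popular D, and sets P, Q
producing the remaining sums. A suitable pair of coset parts with sums off D, both of size at least
s, is structured by induction: D grows, K shrinks, and s drops by the number of discarded elements.
When no pair with sums off D has both parts that large, fewer than s elements account for all sums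
off D, and deleting them leaves a core.

Kneser's theorem is proved beforehand by the same scheme without multiplicities: union-intersection
transform, then descent through smaller subgroups, with holes of P ∪ Q measuring the slack. -/

open Finset

/-! ### Representation functions and truncated sums. -/

section Representation

variable {G : Type*} [AddCommGroup G] [DecidableEq G]

/-- The number of representations `g = a + b` with `a ∈ A` and `b ∈ B`. -/
def rep (A B : Finset G) (g : G) : ℕ := #{a ∈ A | g - a ∈ B}

theorem rep_comm (A B : Finset G) (g : G) : rep A B g = rep B A g := by
  unfold rep
  apply card_bij' (fun a _ => g - a) (fun a _ => g - a) <;> simp +contextual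

theorem addConvolution_eq_rep (A B : Finset G) (g : G) : A.addConvolution B g = rep A B g := by
  unfold rep Finset.addConvolution
  refine card_bij' (fun ab _ => ab.1) (fun a _ => (a, g - a)) ?_ ?_ ?_ ?_
  · rintro ⟨a, b⟩ h
    simp only [mem_filter, mem_product] at h ⊢
    obtain ⟨⟨ha, hb⟩, rfl⟩ := h
    simpa using ⟨ha, hb⟩
  · intro a h
    simpa using h
  · rintro ⟨a, b⟩ h
    simp only [mem_filter, mem_product] at h
    obtain ⟨-, rfl⟩ := h
    simp
  · simp

theorem rep_mono {A A' B B' : Finset G} (hA : A' ⊆ A) (hB : B' ⊆ B) (g : G) :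
    rep A' B' g ≤ rep A B g := by
  apply card_le_card
  intro a ha
  simp only [mem_filter] at ha ⊢
  exact ⟨hA ha.1, hB ha.2⟩

theorem rep_le_card_left (A B : Finset G) (g : G) : rep A B g ≤ #A := card_filter_le _ _

theorem rep_le_card_right (A B : Finset G) (g : G) : rep A B g ≤ #B := by
  rw [rep_comm]; exact rep_le_card_left _ _ _

theorem rep_eq_zero {A B : Finset G} {g : G} (h : g ∉ A + B) : rep A B g = 0 := by
  unfold rep
  rw [card_eq_zero, filter_eq_empty_iff]
  intro a ha hb
  exact h (by simpa using add_mem_add ha hb)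

theorem rep_union_left {A₁ A₂ : Finset G} (h : Disjoint A₁ A₂) (B : Finset G) (g : G) :
    rep (A₁ ∪ A₂) B g = rep A₁ B g + rep A₂ B g := by
  unfold rep
  rw [filter_union, card_union_of_disjoint (disjoint_filter_filter h)]

theorem rep_union_right {B₁ B₂ : Finset G} (A : Finset G) (h : Disjoint B₁ B₂) (g : G) :
    rep A (B₁ ∪ B₂) g = rep A B₁ g + rep A B₂ g := by
  rw [rep_comm, rep_union_left h, rep_comm B₁, rep_comm B₂]

theorem rep_sdiff_left {A A' : Finset G} (h : A' ⊆ A) (B : Finset G) (g : G) :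
    rep A B g = rep A' B g + rep (A \ A') B g := by
  rw [← rep_union_left disjoint_sdiff, union_sdiff_of_subset h]

theorem rep_sdiff_right {B B' : Finset G} (A : Finset G) (h : B' ⊆ B) (g : G) :
    rep A B g = rep A B' g + rep A (B \ B') g := by
  rw [← rep_union_right _ disjoint_sdiff, union_sdiff_of_subset h]

/-- With C = A ∩ B, split A × B according to membership in C; swapping the coordinates of C × (B \
C) assembles the pairs meeting C into (A ∪ B) × C. -/
theorem rep_union_inter (A B : Finset G) (g : G) :
    rep A B g = rep (A ∪ B) (A ∩ B) g + rep (A \ (A ∩ B)) (B \ (A ∩ B)) g := by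
  have hU : A ∪ B = A ∪ (B \ (A ∩ B)) := by
    ext x; simp only [mem_union, mem_sdiff, mem_inter]; tauto
  have hd : Disjoint A (B \ (A ∩ B)) := by
    rw [disjoint_left]; intro x; simp only [mem_sdiff, mem_inter]; tauto
  rw [hU, rep_union_left hd, rep_sdiff_left (inter_subset_left : A ∩ B ⊆ A) B,
    rep_sdiff_left (inter_subset_left : A ∩ B ⊆ A) (A ∩ B),
    rep_sdiff_right (A ∩ B) (inter_subset_right : A ∩ B ⊆ B),
    rep_sdiff_right (A \ (A ∩ B)) (inter_subset_right : A ∩ B ⊆ B),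
    rep_comm (B \ (A ∩ B)) (A ∩ B)]
  ring

theorem rep_vadd_right (x : G) (A B : Finset G) (g : G) : rep A (x +ᵥ B) g = rep A B (g - x) := by
  unfold rep
  congr 1
  apply filter_congr
  intro a _
  rw [← neg_vadd_mem_iff, vadd_eq_add]
  have : -x + (g - a) = g - x - a := by abel
  rw [this]

theorem sum_rep (A B T : Finset G) :
    ∑ g ∈ T, rep A B g = ∑ a ∈ A, #{b ∈ B | a + b ∈ T} := by
  have h : ∀ a : G, #{b ∈ B | a + b ∈ T} = ∑ g ∈ T, if g - a ∈ B then 1 else 0 := by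
    intro a
    rw [← card_filter]
    refine card_bij' (fun b _ => a + b) (fun g _ => g - a) ?_ ?_ ?_ ?_ <;> simp +contextual
  simp_rw [h, rep, card_filter]
  exact sum_comm

theorem sum_rep_of_subset {A B T : Finset G} (h : A + B ⊆ T) :
    ∑ g ∈ T, rep A B g = #A * #B := by
  rw [sum_rep]
  rw [sum_congr rfl (g := fun _ => #B)]
  · simp
  · intro a ha
    congr 1
    rw [filter_eq_self]
    exact fun b hb => h (add_mem_add ha hb)

/-- Partial sum over `g ∉ D` of the number of representations, truncated at `t`. -/
def truncSum (t : ℕ) (A B D : Finset G) : ℕ := ∑ g ∈ (A + B) \ D, min t (rep A B g)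

theorem truncSum_eq {t : ℕ} {A B D T : Finset G} (h : A + B ⊆ T) :
    truncSum t A B D = ∑ g ∈ T \ D, min t (rep A B g) := by
  unfold truncSum
  apply sum_subset (sdiff_subset_sdiff h le_rfl)
  intro g hg hg'
  rw [rep_eq_zero, Nat.min_zero]
  simp only [mem_sdiff] at hg hg'
  tauto

theorem truncSum_empty_eq {t : ℕ} {A B T : Finset G} (h : A + B ⊆ T) :
    truncSum t A B ∅ = ∑ g ∈ T, min t (rep A B g) := by
  rw [truncSum_eq h, sdiff_empty]

theorem truncSum_mono {t : ℕ} {A A' B B' D : Finset G} (hA : A' ⊆ A) (hB : B' ⊆ B) :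
    truncSum t A' B' D ≤ truncSum t A B D := by
  rw [truncSum_eq (add_subset_add hA hB)]
  exact sum_le_sum fun g _ => min_le_min le_rfl (rep_mono hA hB g)

theorem truncSum_eq_of_disjoint {t : ℕ} {A B D : Finset G} (h : Disjoint (A + B) D) :
    truncSum t A B D = truncSum t A B ∅ := by
  unfold truncSum
  rw [sdiff_empty, sdiff_eq_self_of_disjoint h]

/-- After trimming A to exactly t elements, truncation at t discards nothing. -/
theorem mul_card_le_truncSum {t : ℕ} {A B : Finset G} (hA : t ≤ #A) :
    t * #B ≤ truncSum t A B ∅ := by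
  obtain ⟨A₁, hA₁, hc⟩ := exists_subset_card_eq hA
  rw [truncSum_empty_eq le_rfl, ← hc, ← sum_rep_of_subset (add_subset_add_right hA₁), hc]
  exact sum_le_sum fun g _ => le_min (hc ▸ rep_le_card_left _ _ _) (rep_mono hA₁ le_rfl g)

theorem truncSum_comm (t : ℕ) (A B D : Finset G) : truncSum t A B D = truncSum t B A D := by
  unfold truncSum
  rw [add_comm A B]
  exact sum_congr rfl fun g _ => by rw [rep_comm]

theorem truncSum_vadd (t : ℕ) (A B : Finset G) (x : G) :
    truncSum t A (x +ᵥ B) ∅ = truncSum t A B ∅ := by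
  unfold truncSum
  rw [sdiff_empty, sdiff_empty]
  refine sum_bij' (fun g _ => g - x) (fun g _ => g + x) ?_ ?_ ?_ ?_ ?_
  · intro g hg
    have hx : A + (x +ᵥ B) = x +ᵥ (A + B) := add_vadd_comm _ _ _
    rw [hx] at hg
    obtain ⟨y, hy, rfl⟩ := mem_vadd_finset.1 hg
    simpa using hy
  · intro g hg
    have hx : A + (x +ᵥ B) = x +ᵥ (A + B) := add_vadd_comm _ _ _
    rw [hx, add_comm g x, ← vadd_eq_add]
    exact vadd_mem_vadd_finset hg
  · simp
  · simp
  · intro g _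
    rw [rep_vadd_right]

end Representation

/-! ### Finite subgroups, holes, coset parts and stabilizers. -/

section FiniteSubgroup

variable {G : Type*} [AddCommGroup G] [DecidableEq G]

/-- A finite set that is a subgroup. -/
structure IsFinSubgroup (H : Finset G) : Prop where
  zero_mem : (0 : G) ∈ H
  sub_mem : ∀ {x y : G}, x ∈ H → y ∈ H → x - y ∈ H

namespace IsFinSubgroup

variable {H K : Finset G}

omit [DecidableEq G] in
theorem neg_mem (h : IsFinSubgroup H) {x : G} (hx : x ∈ H) : -x ∈ H := by
  simpa using h.sub_mem h.zero_mem hx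

omit [DecidableEq G] in
theorem add_mem (h : IsFinSubgroup H) {x y : G} (hx : x ∈ H) (hy : y ∈ H) : x + y ∈ H := by
  simpa using h.sub_mem hx (h.neg_mem hy)

theorem subset_add (h : IsFinSubgroup H) (A : Finset G) : A ⊆ A + H := fun a ha => by
  simpa using add_mem_add ha h.zero_mem

omit [DecidableEq G] in
theorem card_pos (h : IsFinSubgroup H) : 0 < #H := Finset.card_pos.2 ⟨0, h.zero_mem⟩

theorem add_self (h : IsFinSubgroup H) : H + H = H := by
  apply subset_antisymm _ (h.subset_add H)
  intro x hx
  obtain ⟨a, ha, b, hb, rfl⟩ := mem_add.1 hx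
  exact h.add_mem ha hb

theorem add_of_subset (h : IsFinSubgroup H) (hK : IsFinSubgroup K) (hs : K ⊆ H) : H + K = H :=
  subset_antisymm ((add_subset_add_left hs).trans h.add_self.le) (hK.subset_add H)

theorem card_dvd (h : IsFinSubgroup H) (A : Finset G) : #H ∣ #(A + H) := by
  rw [add_comm]
  apply card_dvd_card_add_left
  rintro _ ⟨a, -, rfl⟩ _ ⟨b, -, rfl⟩ hne
  simp only [Function.onFun, id]
  rw [disjoint_left]
  intro x hx hx'
  apply hne
  simp only [mem_image] at hx hx'
  obtain ⟨y, hy, rfl⟩ := hx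
  obtain ⟨z, hz, hzy⟩ := hx'
  ext w
  simp only [mem_image]
  constructor
  · rintro ⟨v, hv, rfl⟩
    refine ⟨v - y + z, h.add_mem (h.sub_mem hv hy) hz, ?_⟩
    have : b = y + a - z := by rw [← hzy]; abel
    rw [this]; abel
  · rintro ⟨v, hv, rfl⟩
    refine ⟨v - z + y, h.add_mem (h.sub_mem hv hz) hy, ?_⟩
    have : b = y + a - z := by rw [← hzy]; abel
    rw [this]; abel

theorem mem_of_periodic {D : Finset G} (hD : D + H = D) {x y : G} (hx : x ∈ D)
    (hy : y - x ∈ H) : y ∈ D := by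
  rw [← hD]
  exact Finset.mem_add.2 ⟨x, hx, _, hy, by abel⟩

theorem mem_iff_of_periodic (h : IsFinSubgroup H) {D : Finset G} (hD : D + H = D) {x y : G}
    (hy : y - x ∈ H) : x ∈ D ↔ y ∈ D :=
  ⟨fun hx => mem_of_periodic hD hx hy,
    fun hx => mem_of_periodic hD hx (by simpa using h.neg_mem hy)⟩

theorem subset_of_periodic_coset (h : IsFinSubgroup H) {F : Finset G} {a : G}
    (hF : ∀ x ∈ F, x - a ∈ H) (hne : F.Nonempty) (hK : F + K = F) : K ⊆ H := by
  obtain ⟨f, hf⟩ := hne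
  intro x hx
  have h1 : f + x ∈ F := hK ▸ add_mem_add hf hx
  have := h.sub_mem (hF _ h1) (hF _ hf)
  simpa using this

theorem card_le_of_periodic {A : Finset G} (hne : A.Nonempty) (hA : A + H = A) : #H ≤ #A := by
  rw [← hA]
  exact card_le_card_add_left hne

end IsFinSubgroup

/-- The number of `H`-holes of `A`. -/
def holes (H A : Finset G) : ℤ := #(A + H) - #A

theorem IsFinSubgroup.holes_nonneg {H : Finset G} (h : IsFinSubgroup H) (A : Finset G) :
    0 ≤ holes H A := by
  unfold holes
  have := card_le_card (h.subset_add A)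
  omega

/-- The part of `A` in the coset `a + H`. -/
def cosetPart (H : Finset G) (a : G) (A : Finset G) : Finset G := {x ∈ A | x - a ∈ H}

theorem mem_cosetPart {H : Finset G} {a : G} {A : Finset G} {x : G} :
    x ∈ cosetPart H a A ↔ x ∈ A ∧ x - a ∈ H := by simp [cosetPart]

theorem cosetPart_subset (H : Finset G) (a : G) (A : Finset G) : cosetPart H a A ⊆ A :=
  filter_subset _ _

theorem cosetPart_union (H : Finset G) (a : G) (A B : Finset G) :
    cosetPart H a (A ∪ B) = cosetPart H a A ∪ cosetPart H a B := filter_union _ _ _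

theorem card_cosetPart_union_le (H : Finset G) (a : G) (A B : Finset G) :
    #(cosetPart H a (A ∪ B)) ≤ #(cosetPart H a A) + #(cosetPart H a B) := by
  rw [cosetPart_union]; exact card_union_le _ _

namespace IsFinSubgroup

variable {H K : Finset G}

theorem cosetPart_congr (h : IsFinSubgroup H) {a b : G} (hab : b - a ∈ H) (A : Finset G) :
    cosetPart H a A = cosetPart H b A := by
  ext x
  simp only [mem_cosetPart]
  refine and_congr_right fun _ => ⟨fun hx => ?_, fun hx => ?_⟩
  · simpa using h.sub_mem hx hab
  · simpa using h.add_mem hx hab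

theorem card_cosetPart_le (H : Finset G) (a : G) (A : Finset G) : #(cosetPart H a A) ≤ #H := by
  apply card_le_card_of_injOn (fun x => x - a)
  · intro x hx
    exact (mem_cosetPart.1 hx).2
  · intro x _ y _ hxy
    simpa using hxy

theorem card_cosetPart_of_periodic {A : Finset G} {a : G} (hA : A + H = A) (ha : a ∈ A) :
    #(cosetPart H a A) = #H := by
  apply le_antisymm (card_cosetPart_le H a A)
  apply card_le_card_of_injOn (fun x => a + x)
  · intro x hx
    simp only [mem_coe] at hx
    exact mem_cosetPart.2 ⟨hA ▸ add_mem_add ha hx, by simpa using hx⟩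
  · intro x _ y _ hxy
    simpa using hxy

theorem add_add_self (h : IsFinSubgroup H) (A : Finset G) : A + H + H = A + H := by
  rw [add_assoc, h.add_self]

theorem card_le_cosetPart_add_holes (h : IsFinSubgroup H) {A : Finset G} {a : G} (ha : a ∈ A) :
    (#H : ℤ) ≤ #(cosetPart H a A) + holes H A := by
  have h1 := card_cosetPart_of_periodic (h.add_add_self A) (h.subset_add A ha)
  have h2 : cosetPart H a (A + H) ⊆ cosetPart H a A ∪ ((A + H) \ A) := by
    intro x hx
    simp only [mem_cosetPart, mem_union, mem_sdiff] at hx ⊢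
    tauto
  have h3 := (card_le_card h2).trans (card_union_le _ _)
  have h4 := card_sdiff_add_card_eq_card (h.subset_add A)
  unfold holes
  omega

theorem two_mul_card_le_cosetPart_add_holes (h : IsFinSubgroup H) {A : Finset G} {a b : G}
    (ha : a ∈ A) (hb : b ∈ A) (hab : a - b ∉ H) :
    (2 * #H : ℤ) ≤ #(cosetPart H a A) + #(cosetPart H b A) + holes H A := by
  have h1 := card_cosetPart_of_periodic (h.add_add_self A) (h.subset_add A ha)
  have h1' := card_cosetPart_of_periodic (h.add_add_self A) (h.subset_add A hb)
  have hd : Disjoint (cosetPart H a (A + H)) (cosetPart H b (A + H)) := by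
    rw [disjoint_left]
    intro x hx hx'
    apply hab
    simpa using h.sub_mem (mem_cosetPart.1 hx').2 (mem_cosetPart.1 hx).2
  have h2 : cosetPart H a (A + H) ∪ cosetPart H b (A + H) ⊆
      (cosetPart H a A ∪ cosetPart H b A) ∪ ((A + H) \ A) := by
    intro x hx
    simp only [mem_cosetPart, mem_union, mem_sdiff] at hx ⊢
    tauto
  have h3 := (card_le_card h2).trans ((card_union_le _ _).trans
    (Nat.add_le_add_right (card_union_le _ _) _))
  rw [card_union_of_disjoint hd] at h3
  have h4 := card_sdiff_add_card_eq_card (h.subset_add A)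
  unfold holes
  omega

/-- The coset a + K lies entirely in W + K, while inside it W' + H is contained in Z + H. Refining K
to H thus gains |K| − |Z + H| in that one coset. -/
theorem card_add_add_card_le (hK : IsFinSubgroup K) (hs : H ⊆ K)
    {W W' Z : Finset G} (hW : W' ⊆ W) {a : G} (ha : a ∈ W) (hZ : cosetPart K a W' ⊆ Z) :
    #(W' + H) + #K ≤ #(W + K) + #(Z + H) := by
  have h1 := card_cosetPart_of_periodic (hK.add_add_self W) (hK.subset_add W ha)
  have h2 : W' + H ⊆ ((W + K) \ cosetPart K a (W + K)) ∪ (Z + H) := by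
    intro x hx
    obtain ⟨w, hw, y, hy, rfl⟩ := Finset.mem_add.1 hx
    simp only [mem_union, mem_sdiff, mem_cosetPart]
    by_cases hwa : w - a ∈ K
    · exact Or.inr (add_mem_add (hZ (mem_cosetPart.2 ⟨hw, hwa⟩)) hy)
    · refine Or.inl ⟨add_mem_add (hW hw) (hs hy), fun h3 => hwa ?_⟩
      have := hK.sub_mem h3.2 (hs hy)
      convert this using 1; abel
  have h3 := (card_le_card h2).trans (card_union_le _ _)
  have h4 := card_sdiff_add_card_eq_card (cosetPart_subset K a (W + K))
  omega

/-- Pigeonhole in one coset: the part of A in a + H, shifted by −a, and the part of B in b + H,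
reflected through b, are subsets of H, and their common elements give representations of a + b. -/
theorem card_sub_holes_le_rep (h : IsFinSubgroup H) {A B : Finset G} {g : G} (hg : g ∈ A + B) :
    (#H : ℤ) - holes H A - holes H B ≤ rep A B g := by
  obtain ⟨a, ha, b, hb, rfl⟩ := Finset.mem_add.1 hg
  have h1 := h.card_le_cosetPart_add_holes ha
  have h2 := h.card_le_cosetPart_add_holes hb
  set X := (cosetPart H a A).image (fun x => x - a) with hX
  set Y := (cosetPart H b B).image (fun x => b - x) with hY
  have hXc : #X = #(cosetPart H a A) :=
    card_image_of_injective _ fun x y hxy => by simpa using hxy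
  have hYc : #Y = #(cosetPart H b B) :=
    card_image_of_injective _ fun x y hxy => by simpa using hxy
  have hU : X ∪ Y ⊆ H := by
    intro z hz
    simp only [hX, hY, mem_union, mem_image, mem_cosetPart] at hz
    rcases hz with ⟨x, hx, rfl⟩ | ⟨x, hx, rfl⟩
    · exact hx.2
    · simpa using h.neg_mem hx.2
  have hI : #(X ∩ Y) ≤ rep A B (a + b) := by
    apply card_le_card_of_injOn (fun x => x + a)
    · intro z hz
      simp only [hX, hY, coe_inter, Set.mem_inter_iff, mem_coe, mem_image,
        mem_cosetPart] at hz
      obtain ⟨⟨x, hx, rfl⟩, y, hy, hxy⟩ := hz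
      simp only [coe_filter, Set.mem_ofPred_eq, sub_add_cancel]
      refine ⟨hx.1, ?_⟩
      have : a + b - x = y := by
        have : b - y - (x - a) = 0 := by rw [hxy]; abel
        rw [← sub_eq_zero, ← this]; abel
      rw [this]; exact hy.1
    · intro x _ y _ hxy
      simpa using hxy
  have := card_union_add_card_inter X Y
  have := card_le_card hU
  omega

end IsFinSubgroup

/-- The stabilizer of a finite set, as a finite set. -/
def finStab (D : Finset G) : Finset G := {x ∈ D - D | x +ᵥ D = D}

theorem mem_finStab {D : Finset G} (hD : D.Nonempty) {x : G} : x ∈ finStab D ↔ x +ᵥ D = D := by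
  unfold finStab
  rw [mem_filter, and_iff_right_iff_imp]
  intro h
  obtain ⟨d, hd⟩ := hD
  have : x +ᵥ d ∈ D := h ▸ vadd_mem_vadd_finset hd
  simpa using sub_mem_sub this hd

theorem isFinSubgroup_finStab {D : Finset G} (hD : D.Nonempty) : IsFinSubgroup (finStab D) where
  zero_mem := by rw [mem_finStab hD, zero_vadd]
  sub_mem := by
    intro x y hx hy
    rw [mem_finStab hD] at hx hy ⊢
    rw [sub_eq_add_neg, add_vadd]
    nth_rw 1 [← hy]
    rw [neg_vadd_vadd, hx]

theorem add_finStab {D : Finset G} (hD : D.Nonempty) : D + finStab D = D := by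
  apply subset_antisymm _ ((isFinSubgroup_finStab hD).subset_add D)
  intro x hx
  obtain ⟨d, hd, y, hy, rfl⟩ := mem_add.1 hx
  rw [mem_finStab hD] at hy
  rw [← hy, add_comm, ← vadd_eq_add]
  exact vadd_mem_vadd_finset hd

theorem subset_finStab {D H : Finset G} (hD : D.Nonempty)
    (hDH : D + H = D) : H ⊆ finStab D := by
  intro x hx
  rw [mem_finStab hD]
  apply eq_of_subset_of_card_le
  · intro y hy
    obtain ⟨d, hd, rfl⟩ := mem_vadd_finset.1 hy
    rw [vadd_eq_add, add_comm]
    have := add_mem_add hd hx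
    rwa [hDH] at this
  · simp

end FiniteSubgroup

/-! ### Kneser's theorem. -/

section Kneser

variable {G : Type*} [AddCommGroup G] [DecidableEq G]

/-- Saturating A and B by the stabilizer of A + B does not change the sumset, and any period H of it
is contained in that stabilizer. -/
theorem exists_kneser_stab {A B : Finset G} (hA : A.Nonempty) (hB : B.Nonempty)
    (h : ∃ H, IsFinSubgroup H ∧
      A + finStab (A + B) + (B + finStab (A + B)) + H =
        A + finStab (A + B) + (B + finStab (A + B)) ∧
      #(A + finStab (A + B)) + #(B + finStab (A + B)) ≤
        #(A + finStab (A + B) + (B + finStab (A + B))) + #H) :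
    #(A + finStab (A + B)) + #(B + finStab (A + B)) ≤ #(A + B) + #(finStab (A + B)) := by
  obtain ⟨H, hH, hper, hcard⟩ := h
  have hne := hA.add hB
  have hsum : A + finStab (A + B) + (B + finStab (A + B)) = A + B := by
    rw [add_add_add_comm, (isFinSubgroup_finStab hne).add_self, add_finStab hne]
  rw [hsum] at hper hcard
  have := card_le_card (subset_finStab hne hper)
  omega

theorem IsFinSubgroup.add_subset_coset {H X Y : Finset G} (hH : IsFinSubgroup H) {a b : G}
    (hX : ∀ x ∈ X, x - a ∈ H) (hY : ∀ y ∈ Y, y - b ∈ H) : ∀ z ∈ X + Y, z - (a + b) ∈ H := by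
  intro z hz
  obtain ⟨x, hx, y, hy, rfl⟩ := mem_add.1 hz
  rw [add_sub_add_comm]
  exact hH.add_mem (hX x hx) (hY y hy)

theorem IsFinSubgroup.disjoint_coset {K D F : Finset G} (hK : IsFinSubgroup K) (hD : D + K = D)
    {c : G} (hc : c ∉ D) (hF : ∀ z ∈ F, z - c ∈ K) : Disjoint F D := by
  rw [disjoint_left]
  intro z hz hzD
  exact hc ((hK.mem_iff_of_periodic hD (hF z hz)).2 hzD)

theorem holes_le_of_cosetPart {K H W W' Z : Finset G} (hK : IsFinSubgroup K)
    (hs : H ⊆ K) (hW : W' ⊆ W) {a : G} (ha : a ∈ W) (hZ : cosetPart K a W' ⊆ Z) :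
    holes H W' + #K ≤ holes K W + #(Z + H) + (#W - #W') := by
  have := hK.card_add_add_card_le hs hW ha hZ
  unfold holes
  omega

theorem holes_le_of_subset {K H W W' : Finset G} (hs : H ⊆ K) (hW : W' ⊆ W) :
    holes H W' ≤ holes K W + (#W - #W') := by
  have := card_le_card (add_subset_add hW hs)
  unfold holes
  omega

/-- Induction on |K|. A sum a + b off D gives coset parts X, Y whose sumset is disjoint from D,
hence smaller than A + B; Kneser for (X, Y) lets D absorb X + Y at the cost of replacing K by a
proper subgroup. The invariant survives because the change in |D| + |K| is paid for by the drop in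
holes. -/
theorem kneser_descent {A B : Finset G}
    (ih : ∀ X Y : Finset G, X.Nonempty → Y.Nonempty → #(X + Y) < #(A + B) →
      ∃ H, IsFinSubgroup H ∧ X + Y + H = X + Y ∧ #(X + H) + #(Y + H) ≤ #(X + Y) + #H)
    (n : ℕ) : ∀ K D P Q : Finset G, #K ≤ n → IsFinSubgroup K → D + K = D → D.Nonempty →
      D ⊆ A + B → P ⊆ A → Q ⊆ B → (∀ a ∈ A, ∀ b ∈ B, a + b ∉ D → a ∈ P ∧ b ∈ Q) →
      (#A + #B : ℤ) + holes K (P ∪ Q) ≤ #D + #K →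
      ∃ H, IsFinSubgroup H ∧ A + B + H = A + B ∧ #A + #B ≤ #(A + B) + #H := by
  induction n with
  | zero =>
    intro K D P Q hn hK
    have := hK.card_pos
    omega
  | succ n ihn =>
    intro K D P Q hn hK hDK hDne hDs hP hQ hbad hcard
    by_cases hdone : #A + #B ≤ #(A + B) + 1
    · exact ⟨{0}, ⟨by simp, fun hx hy => by simp_all⟩, by rw [singleton_zero, add_zero], by simpa using hdone⟩
    have hσ := hK.holes_nonneg (P ∪ Q)
    by_cases hall : ∀ a ∈ A, ∀ b ∈ B, a + b ∈ D
    · have hD : D = A + B := by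
        apply subset_antisymm hDs
        intro x hx
        obtain ⟨a, ha, b, hb, rfl⟩ := mem_add.1 hx
        exact hall a ha b hb
      exact ⟨K, hK, hD ▸ hDK, by rw [← hD]; omega⟩
    have grow : ∀ a ∈ P, ∀ b ∈ Q, a + b ∉ D →
        #D + #(cosetPart K a P + cosetPart K b Q) ≤ #(A + B) := by
      intro a ha b hb hab
      have hdis := hK.disjoint_coset hDK hab (hK.add_subset_coset
        (fun x hx => (mem_cosetPart.1 hx).2) (fun x hx => (mem_cosetPart.1 hx).2) :
          ∀ z ∈ cosetPart K a P + cosetPart K b Q, _)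
      rw [← card_union_of_disjoint hdis.symm]
      exact card_le_card (union_subset hDs (add_subset_add ((cosetPart_subset _ _ _).trans hP)
        ((cosetPart_subset _ _ _).trans hQ)))
    have step : ∀ a ∈ P, ∀ b ∈ Q, a + b ∉ D →
        (a - b ∈ K ∨ (2 * #K : ℤ) ≤
          2 * (#(cosetPart K a P) + #(cosetPart K b Q)) + holes K (P ∪ Q)) →
        ∃ H, IsFinSubgroup H ∧ A + B + H = A + B ∧ #A + #B ≤ #(A + B) + #H := by
      intro a ha b hb hab hor
      have haX : a ∈ cosetPart K a P := mem_cosetPart.2 ⟨ha, by simpa using hK.zero_mem⟩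
      have hbY : b ∈ cosetPart K b Q := mem_cosetPart.2 ⟨hb, by simpa using hK.zero_mem⟩
      set X := cosetPart K a P with hX
      set Y := cosetPart K b Q with hY
      have hXs : ∀ x ∈ X, x - a ∈ K := fun x hx => (mem_cosetPart.1 hx).2
      have hYs : ∀ x ∈ Y, x - b ∈ K := fun x hx => (mem_cosetPart.1 hx).2
      have hFs := hK.add_subset_coset hXs hYs
      have hdis := hK.disjoint_coset hDK hab hFs
      have hFne : (X + Y).Nonempty := ⟨_, add_mem_add haX hbY⟩
      have hXY : X + Y ⊆ A + B := add_subset_add ((cosetPart_subset _ _ _).trans hP)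
        ((cosetPart_subset _ _ _).trans hQ)
      have hDF : #(D ∪ (X + Y)) = #D + #(X + Y) := card_union_of_disjoint hdis.symm
      have hDFs : #D + #(X + Y) ≤ #(A + B) := grow a ha b hb hab
      have hDpos := hDne.card_pos
      obtain ⟨H, hH, hper, hkn⟩ := ih X Y ⟨a, haX⟩ ⟨b, hbY⟩ (by omega)
      have hHK : H ⊆ K := hK.subset_of_periodic_coset hFs hFne hper
      have hFle := IsFinSubgroup.card_le_of_periodic hFne hper
      -- Were H = K, X + Y would have at least |K| elements off D, giving |A| + |B| ≤ |A + B|, which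
      -- `hdone` excludes.
      have hlt : #H < #K := by
        by_contra hcon
        have := card_le_card hHK
        omega
      have hXH := card_le_card (hH.subset_add X)
      have hYH := card_le_card (hH.subset_add Y)
      have hdvdK : #H ∣ #K := by
        have := hH.card_dvd K
        rwa [hK.add_of_subset hH hHK] at this
      have hdvdm : #H ∣ #(X + H) + #(Y + H) := dvd_add (hH.card_dvd X) (hH.card_dvd Y)
      have haW : a ∈ P ∪ Q := mem_union_left _ ha
      have key : holes H (P ∪ Q) ≤
          holes K (P ∪ Q) - max 0 (#K - ((#(X + H) : ℤ) + #(Y + H))) := by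
        rcases le_or_gt (#K) (#(X + H) + #(Y + H)) with hm | hm
        · have := holes_le_of_subset hHK (le_refl (P ∪ Q))
          rw [max_eq_left (by omega)]
          omega
        · rcases hor with hor | hor
          -- X and Y lie in the same coset, so there P ∪ Q is covered by (X + H) ∪ (Y + H), and the
          -- rest of the coset no longer counts as holes.
          · have hZ : cosetPart K a (P ∪ Q) ⊆ X ∪ Y := by
              rw [cosetPart_union]
              apply union_subset_union le_rfl
              rw [hY, hK.cosetPart_congr (by simpa using hK.neg_mem hor)]
            have h1 := holes_le_of_cosetPart hK hHK le_rfl haW hZ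
            have h2 := card_union_le (X + H) (Y + H)
            rw [← union_add] at h2
            rw [max_eq_right (by omega)]
            omega
          -- Divisibility by |H| makes the deficit |K| − |X + H| − |Y + H| at least |H|; by `hor`
          -- there are at least twice that many holes, too many for `hcard`.
          · exfalso
            have h3 := Nat.le_of_dvd (by omega) (Nat.dvd_sub hdvdK hdvdm)
            omega
      refine ihn H (D ∪ (X + Y)) P Q (by omega) hH ?_ (hDne.mono subset_union_left)
        (union_subset hDs hXY) hP hQ ?_ ?_
      · rw [union_add, hper]
        congr 1
        conv_lhs => rw [← hDK, add_assoc, hK.add_of_subset hH hHK, hDK]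
      · intro a ha b hb hab
        exact hbad a ha b hb fun h => hab (mem_union_left _ h)
      · rw [hDF]
        push_cast
        rcases max_cases (0 : ℤ) (#K - ((#(X + H) : ℤ) + #(Y + H))) with h | h <;> omega
    push Not at hall
    obtain ⟨a, ha, b, hb, hab⟩ := hall
    obtain ⟨ha, hb⟩ := hbad a ha b hb hab
    by_cases hor : a - b ∈ K
    · exact step a ha b hb hab (Or.inl hor)
    have haW : a ∈ P ∪ Q := mem_union_left _ ha
    have hbW : b ∈ P ∪ Q := mem_union_right _ hb
    have h2 := hK.two_mul_card_le_cosetPart_add_holes haW hbW hor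
    have h3 := card_cosetPart_union_le K a P Q
    have h4 := card_cosetPart_union_le K b P Q
    by_cases ho : (2 * #K : ℤ) ≤
          2 * (#(cosetPart K a P) + #(cosetPart K b Q)) + holes K (P ∪ Q)
    · exact step a ha b hb hab (Or.inr ho)
    have hgrow := grow a ha b hb hab
    have haX : a ∈ cosetPart K a P := mem_cosetPart.2 ⟨ha, by simpa using hK.zero_mem⟩
    have hbY : b ∈ cosetPart K b Q := mem_cosetPart.2 ⟨hb, by simpa using hK.zero_mem⟩
    have hX : #(cosetPart K a P) ≤ #(cosetPart K a P + cosetPart K b Q) :=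
      card_le_card_add_right ⟨b, hbY⟩
    have hY : #(cosetPart K b Q) ≤ #(cosetPart K a P + cosetPart K b Q) :=
      card_le_card_add_left ⟨a, haX⟩
    rcases (cosetPart K b P).eq_empty_or_nonempty with he | ⟨a', ha'⟩
    · have := hK.card_le_cosetPart_add_holes hbW
      rw [he, card_empty] at h4
      omega
    rcases (cosetPart K a Q).eq_empty_or_nonempty with he | ⟨b', hb'⟩
    · have := hK.card_le_cosetPart_add_holes haW
      rw [he, card_empty] at h3
      omega
    rw [mem_cosetPart] at ha' hb'
    -- Swap the cosets: a' + b' lies in the same coset as a + b, and since the four parts of P and Q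
    -- in the two cosets total at least 2|K| minus the holes, failure for one crossing gives the
    -- inequality for the other.
    refine step a' ha'.1 b' hb'.1 (fun h => hab ?_) (Or.inr ?_)
    · refine (hK.mem_iff_of_periodic hDK ?_).1 h
      have := hK.neg_mem (hK.add_mem ha'.2 hb'.2)
      convert this using 1; abel
    · rw [← hK.cosetPart_congr ha'.2, ← hK.cosetPart_congr hb'.2]
      omega

/-- Lexicographic induction: smaller sumset, then larger |A| + |B|, then smaller |B|. The transform
keeps |A| + |B|, does not enlarge the sumset and shrinks the second set. -/
theorem kneser_induction (p : ℕ) : ∀ q r : ℕ, ∀ A B : Finset G, A.Nonempty → B.Nonempty →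
    #(A + B) = p → 2 * #(A + B) - (#A + #B) = q → #B = r →
    ∃ H, IsFinSubgroup H ∧ A + B + H = A + B ∧ #A + #B ≤ #(A + B) + #H := by
  induction p using Nat.strong_induction_on with | _ p ihp => ?_
  intro q
  induction q using Nat.strong_induction_on with | _ q ihq => ?_
  intro r
  induction r using Nat.strong_induction_on with | _ r ihr => ?_
  intro A B hA hB hp hq hr
  -- If this holds, B − b lies in the stabilizer of A, whose size is therefore at least |B|.
  by_cases hall : ∀ a ∈ A, ∀ b ∈ B, (a - b) +ᵥ B ⊆ A
  · obtain ⟨b, hb⟩ := hB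
    refine ⟨finStab A, isFinSubgroup_finStab hA, ?_, ?_⟩
    · rw [add_right_comm, add_finStab hA]
    · have h1 : #A ≤ #(A + B) := card_le_card_add_right ⟨b, hb⟩
      have h2 : #B ≤ #(finStab A) := by
        apply card_le_card_of_injOn (fun x => x - b)
        · intro x hx
          rw [mem_coe, mem_finStab hA]
          apply eq_of_subset_of_card_le
          · intro y hy
            obtain ⟨a, ha, rfl⟩ := mem_vadd_finset.1 hy
            have := hall a ha b hb (vadd_mem_vadd_finset (a := a - b) hx)
            convert this using 1
            simp only [vadd_eq_add]; abel
          · simp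
        · intro x _ y _ hxy
          simpa using hxy
      omega
  push Not at hall
  obtain ⟨a, ha, b, hb, hab⟩ := hall
  have hvadd : A + ((a - b) +ᵥ B) = (a - b) +ᵥ (A + B) := add_vadd_comm _ _ _
  have hBc : #((a - b) +ᵥ B) = #B := card_vadd_finset _ _
  have hSc : #((a - b) +ᵥ (A + B)) = #(A + B) := card_vadd_finset _ _
  have haB : a ∈ (a - b) +ᵥ B := by
    have := vadd_mem_vadd_finset (a := a - b) hb
    simpa using this
  suffices h : ∃ H, IsFinSubgroup H ∧ A + ((a - b) +ᵥ B) + H = A + ((a - b) +ᵥ B) ∧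
      #A + #((a - b) +ᵥ B) ≤ #(A + ((a - b) +ᵥ B)) + #H by
    obtain ⟨H, hH, hper, hcard⟩ := h
    refine ⟨H, hH, ?_, by rw [hvadd] at hcard; omega⟩
    rw [hvadd, vadd_add_assoc] at hper
    exact vadd_left_cancel _ hper
  set B' := (a - b) +ᵥ B with hB'
  have hSc' : #(A + B') = #(A + B) := by rw [hvadd, hSc]
  have hAs : #A ≤ #(A + B) := card_le_card_add_right ⟨b, hb⟩
  have hBs : #B ≤ #(A + B) := card_le_card_add_left hA
  -- Saturation by the stabilizer either increases |X| + |Y|, lowering the second measure, or leaves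
  -- |Y| unchanged, so the saturated pair is still covered by induction.
  have strong : ∀ X Y : Finset G, X.Nonempty → Y.Nonempty → (#(X + Y) < #(A + B) ∨
      #(X + Y) ≤ #(A + B) ∧ #X + #Y = #A + #B ∧ #Y < #B) →
      ∃ H, IsFinSubgroup H ∧ X + Y + H = X + Y ∧ #(X + H) + #(Y + H) ≤ #(X + Y) + #H := by
    intro X Y hX hY hlt
    have hne := hX.add hY
    have hS := isFinSubgroup_finStab hne
    refine ⟨_, hS, add_finStab hne, exists_kneser_stab hX hY ?_⟩
    have hsum : X + finStab (X + Y) + (Y + finStab (X + Y)) = X + Y := by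
      rw [add_add_add_comm, hS.add_self, add_finStab hne]
    have hX' := hX.mono (hS.subset_add X)
    have hY' := hY.mono (hS.subset_add Y)
    have h3 := card_le_card (hS.subset_add X)
    have h4 := card_le_card (hS.subset_add Y)
    generalize X + finStab (X + Y) = X' at *
    generalize Y + finStab (X + Y) = Y' at *
    have h1 : #X' ≤ #(X + Y) := hsum ▸ card_le_card_add_right hY'
    have h2 : #Y' ≤ #(X + Y) := hsum ▸ card_le_card_add_left hX'
    by_cases hc : #(X + Y) < #(A + B)
    · exact ihp _ (hp ▸ hc) _ _ _ _ hX' hY' (by rw [hsum]) rfl rfl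
    have hpe : #(X' + Y') = p := by rw [hsum]; omega
    by_cases hc' : #X + #Y < #X' + #Y'
    · exact ihq (2 * #(X' + Y') - (#X' + #Y')) (by rw [hsum]; omega) _ _ _ hX' hY' hpe rfl rfl
    · exact ihr #Y' (by omega) _ _ hX' hY' hpe (by rw [hsum]; omega) rfl
  have hC : (A ∩ B').Nonempty := ⟨a, mem_inter.2 ⟨ha, haB⟩⟩
  have hU : (A ∪ B').Nonempty := ⟨a, mem_union_left _ ha⟩
  have hUC : A ∪ B' + A ∩ B' ⊆ A + B' := by
    rw [union_add]
    apply union_subset (add_subset_add_left inter_subset_right)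
    rw [add_comm]
    exact add_subset_add_right inter_subset_left
  have hUCc := card_union_add_card_inter A B'
  have hClt : #(A ∩ B') < #B' := by
    apply card_lt_card
    refine ⟨inter_subset_right, fun h => hab fun x hx => (mem_inter.1 (h hx)).1⟩
  obtain ⟨H, hH, hper, hkn⟩ := strong _ _ hU hC
    (Or.inr ⟨(card_le_card hUC).trans hSc'.le, by omega, by omega⟩)
  set C := A ∩ B' with hCdef
  set D := A ∪ B' + C with hD
  -- An element of C + H sends all of A ∪ B' into the periodic set D, so only elements outside C + H
  -- can produce sums off D.
  have hbad : ∀ x ∈ A ∪ B', x ∈ C + H → ∀ y ∈ A ∪ B', x + y ∈ D := by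
    intro x _ hxC y hy
    obtain ⟨c, hc, k, hk, rfl⟩ := mem_add.1 hxC
    rw [← hper]
    have := add_mem_add (add_mem_add hy hc) hk
    convert this using 1; abel
  refine kneser_descent (fun X Y hX hY h => strong X Y hX hY (Or.inl (hSc' ▸ h))) (#H) H D
    (A \ (C + H)) (B' \ (C + H)) le_rfl hH hper (hU.add hC) hUC sdiff_subset sdiff_subset ?_ ?_
  · intro x hx y hy hxy
    have hx' := mem_union_left B' hx
    have hy' := mem_union_right A hy
    refine ⟨mem_sdiff.2 ⟨hx, fun h => hxy (hbad x hx' h y hy')⟩,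
      mem_sdiff.2 ⟨hy, fun h => hxy ?_⟩⟩
    rw [add_comm]
    exact hbad y hy' h x hx'
  · rw [← union_sdiff_distrib]
    have h1 : (A ∪ B') \ (C + H) + H ⊆ (A ∪ B' + H) \ (C + H) := by
      intro z hz
      obtain ⟨x, hx, k, hk, rfl⟩ := mem_add.1 hz
      rw [mem_sdiff] at hx ⊢
      refine ⟨add_mem_add hx.1 hk, fun h => hx.2 ?_⟩
      exact (hH.mem_iff_of_periodic (hH.add_add_self C) (by simpa using hk)).2 h
    have h2 := card_le_card h1
    have h3 : #((A ∪ B' + H) \ (C + H)) + #(C + H) = #(A ∪ B' + H) :=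
      card_sdiff_add_card_eq_card (add_subset_add_right (inter_subset_left.trans
        subset_union_left))
    have h4 := le_card_sdiff (C + H) (A ∪ B')
    have h5 := card_le_card (hH.subset_add C)
    unfold holes
    omega

/-- **Kneser's theorem**: if `H` is the stabilizer of `A + B`,
then `|A + H| + |B + H| ≤ |A + B| + |H|`. -/
theorem kneser {A B : Finset G} (hA : A.Nonempty) (hB : B.Nonempty) :
    #(A + finStab (A + B)) + #(B + finStab (A + B)) ≤ #(A + B) + #(finStab (A + B)) := by
  have hS := isFinSubgroup_finStab (hA.add hB)
  exact exists_kneser_stab hA hB (kneser_induction _ _ _ _ _ (hA.mono (hS.subset_add A))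
    (hB.mono (hS.subset_add B)) rfl rfl rfl)

end Kneser

/-! ### From a popular core to the structured pair. -/

section Structured

variable {G : Type*} [AddCommGroup G] [DecidableEq G]

/-- One sum a + b off the periodic set D drags along a plus the whole part of B in b + H. -/
theorem card_mul_le_sum_rep {H D E B T : Finset G} (hH : IsFinSubgroup H) (hD : D + H = D)
    (hE : ∀ a ∈ E, ∃ b ∈ B, a + b ∉ D) (hT : E + B ⊆ T) :
    (#E : ℤ) * (#H - holes H B) ≤ ∑ g ∈ T \ D, (rep E B g : ℤ) := by
  rw [← Nat.cast_sum, sum_rep, Nat.cast_sum, ← nsmul_eq_mul]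
  apply card_nsmul_le_sum
  intro a ha
  obtain ⟨b, hb, hab⟩ := hE a ha
  have h1 := hH.card_le_cosetPart_add_holes hb
  have h2 : cosetPart H b B ⊆ {b ∈ B | a + b ∈ T \ D} := by
    intro x hx
    rw [mem_cosetPart] at hx
    rw [mem_filter, mem_sdiff]
    refine ⟨hx.1, hT (add_mem_add ha hx.1), fun h => hab ?_⟩
    exact (hH.mem_iff_of_periodic hD (by simpa using hx.2)).2 h
  have h3 := card_le_card h2
  omega

theorem card_add_card_mul_le_sum_rep {H D A B E F T : Finset G} (hH : IsFinSubgroup H)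
    (hD : D + H = D) (hE : ∀ a ∈ E, ∃ b ∈ B, a + b ∉ D) (hF : ∀ b ∈ F, ∃ a ∈ A, a + b ∉ D)
    (hT : E + B ⊆ T) (hT' : A + F ⊆ T) :
    ((#E + #F : ℕ) : ℤ) * (#H - (holes H A + holes H B)) ≤
      ∑ g ∈ T \ D, ((rep E B g + rep A F g : ℕ) : ℤ) := by
  have h1 := card_mul_le_sum_rep hH hD hE hT
  have h2 := card_mul_le_sum_rep (B := A) (T := T) hH hD
    (fun b hb => by simpa only [add_comm] using hF b hb) (by rwa [add_comm])
  simp_rw [rep_comm F A] at h2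
  simp_rw [Nat.cast_add, sum_add_distrib]
  have h3 := mul_nonneg (Nat.cast_nonneg (α := ℤ) #E) (hH.holes_nonneg A)
  have h4 := mul_nonneg (Nat.cast_nonneg (α := ℤ) #F) (hH.holes_nonneg B)
  linarith

theorem rep_add_rep_add_rep_le {A B A' B' E F : Finset G} (hA : A' ⊆ A) (hB : B' ⊆ B)
    (hE : E ⊆ A \ A') (hF : F ⊆ B \ B') (g : G) :
    rep A' B' g + (rep E B' g + rep A' F g) ≤ rep A B g := by
  rw [rep_sdiff_left hA B, rep_sdiff_right A' hB]
  have h1 := rep_mono hE hB g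
  have h2 := rep_mono (le_refl A') hF g
  omega

theorem rep_add_rep_le_card_add_card (A B E F : Finset G) (g : G) :
    rep E B g + rep A F g ≤ #E + #F :=
  Nat.add_le_add (rep_le_card_left _ _ _) (rep_le_card_right _ _ _)

/-- The structure of a pair `(A, B)` with few `t`-representable sums: after removing fewer than
`t` elements, `A' + B'` has a stabilizer that is large in terms of `t` and the number of holes. -/
structure Structured (t : ℕ) (A B A' B' : Finset G) : Prop where
  subset_left : A' ⊆ A
  subset_right : B' ⊆ B
  nonempty_left : A'.Nonempty
  nonempty_right : B'.Nonempty
  lt : #(A \ A') + #(B \ B') < t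
  two_mul_le : 2 * t + (holes (finStab (A' + B')) A' + holes (finStab (A' + B')) B') ≤
    #(finStab (A' + B'))
  exists_left : ∀ a ∈ A \ A', ∃ b ∈ B', a + b ∉ A' + B'
  exists_right : ∀ b ∈ B \ B', ∃ a ∈ A', a + b ∉ A' + B'

namespace Structured

variable {t : ℕ} {A B A' B' : Finset G}

theorem isFinSubgroup (h : Structured t A B A' B') : IsFinSubgroup (finStab (A' + B')) :=
  isFinSubgroup_finStab (h.nonempty_left.add h.nonempty_right)

theorem periodic (h : Structured t A B A' B') : A' + B' + finStab (A' + B') = A' + B' :=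
  add_finStab (h.nonempty_left.add h.nonempty_right)

theorem card_add_card_add_holes_le (h : Structured t A B A' B') :
    (#A' + #B' : ℤ) + (holes (finStab (A' + B')) A' + holes (finStab (A' + B')) B') ≤
      #(A' + B') + #(finStab (A' + B')) := by
  have := kneser h.nonempty_left h.nonempty_right
  unfold holes
  omega

theorem two_mul_le_rep (h : Structured t A B A' B') {g : G} (hg : g ∈ A' + B') :
    2 * t ≤ rep A' B' g := by
  have h1 := h.isFinSubgroup.card_sub_holes_le_rep hg
  have h2 := h.two_mul_le
  omega

/-- On A' + B' the truncation is saturated. Elsewhere the l removed elements contribute at most l to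
each sum, so the remaining capacity t − l is available for an additional weight r. -/
theorem sum_min_le (h : Structured t A B A' B') (r : G → ℕ) {T : Finset G} (hT : A + B ⊆ T) :
    (t * #(A' + B') + ((#(A \ A') + #(B \ B') : ℕ) : ℤ) * (#(finStab (A' + B')) -
      (holes (finStab (A' + B')) A' + holes (finStab (A' + B')) B')) +
      (∑ g ∈ T \ (A' + B'), min (t - (#(A \ A') + #(B \ B'))) (r g) : ℕ) : ℤ) ≤
      (∑ g ∈ T, min t (rep A B g + r g) : ℕ) := by
  have hD : A' + B' ⊆ T := (add_subset_add h.subset_left h.subset_right).trans hT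
  have h1 := card_add_card_mul_le_sum_rep (T := T) h.isFinSubgroup h.periodic h.exists_left
    h.exists_right ((add_subset_add sdiff_subset h.subset_right).trans hT)
    ((add_subset_add h.subset_left sdiff_subset).trans hT)
  have h2 : t * #(A' + B') ≤ ∑ g ∈ A' + B', min t (rep A B g + r g) := by
    rw [mul_comm, ← smul_eq_mul]
    apply card_nsmul_le_sum
    intro g hg
    have := h.two_mul_le_rep hg
    have := rep_mono h.subset_left h.subset_right g
    apply le_min le_rfl
    omega
  have h3 : (∑ g ∈ T \ (A' + B'), (rep (A \ A') B' g + rep A' (B \ B') g)) +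
      (∑ g ∈ T \ (A' + B'), min (t - (#(A \ A') + #(B \ B'))) (r g)) ≤
      ∑ g ∈ T \ (A' + B'), min t (rep A B g + r g) := by
    rw [← sum_add_distrib]
    apply sum_le_sum
    intro g _
    have h4 := rep_add_rep_add_rep_le h.subset_left h.subset_right le_rfl le_rfl g
    have h5 := rep_add_rep_le_card_add_card A' B' (A \ A') (B \ B') g
    have h6 := h.lt
    omega
  rw [← Nat.cast_sum] at h1
  rw [← sum_sdiff hD]
  zify at h2 h3 ⊢
  push_cast at h1
  linarith

theorem le_truncSum (h : Structured t A B A' B') :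
    (t * #(A' + B') + ((#(A \ A') + #(B \ B') : ℕ) : ℤ) * (#(finStab (A' + B')) -
      (holes (finStab (A' + B')) A' + holes (finStab (A' + B')) B')) : ℤ) ≤
      truncSum t A B ∅ := by
  have := h.sum_min_le (fun _ => 0) (le_refl (A + B))
  rw [truncSum_empty_eq le_rfl]
  simpa using this

end Structured

theorem two_mul_le_card_of_truncSum_le {t : ℕ} {A B : Finset G} (ht : 1 ≤ t) (hA : t ≤ #A)
    (hN : (truncSum t A B ∅ : ℤ) ≤ t * (#A + #B) - 2 * t ^ 2) : 2 * t ≤ #A := by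
  have h1 := mul_card_le_truncSum (B := B) hA
  zify at h1 ⊢
  have h2 : (t : ℤ) * (2 * t) ≤ t * #A := by nlinarith
  exact le_of_mul_le_mul_left h2 (by exact_mod_cast ht)

/-- A' and B' are maximal for A' + B' = D, so every element left out has a sum off D and contributes
at least |H| − ρ there; Kneser compares this with |A'| + |B'|. -/
theorem exists_structured {t : ℕ} {A B A₀ B₀ : Finset G} (ht : 1 ≤ t) (hA : t ≤ #A)
    (hB : t ≤ #B) (hN : (truncSum t A B ∅ : ℤ) ≤ t * (#A + #B) - 2 * t ^ 2)
    (hA₀ : A₀ ⊆ A) (hB₀ : B₀ ⊆ B) (hlt : #(A \ A₀) + #(B \ B₀) < 2 * t)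
    (hpop : ∀ a ∈ A₀, ∀ b ∈ B₀, t ≤ rep A B (a + b)) :
    ∃ A' B', Structured t A B A' B' := by
  have hA2 := two_mul_le_card_of_truncSum_le ht hA hN
  have hB2 : 2 * t ≤ #B :=
    two_mul_le_card_of_truncSum_le ht hB (by rw [truncSum_comm, add_comm (#B : ℤ)]; exact hN)
  have hAc := card_sdiff_add_card_eq_card hA₀
  have hBc := card_sdiff_add_card_eq_card hB₀
  have hA₀ne : A₀.Nonempty := card_pos.1 (by omega)
  have hB₀ne : B₀.Nonempty := card_pos.1 (by omega)
  set D := A₀ + B₀ with hD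
  obtain ⟨A', hA'⟩ : ∃ A' : Finset G, A' = {a ∈ A | ∀ b ∈ B₀, a + b ∈ D} := ⟨_, rfl⟩
  obtain ⟨B', hB'⟩ : ∃ B' : Finset G, B' = {b ∈ B | ∀ a ∈ A', a + b ∈ D} := ⟨_, rfl⟩
  have hAA' : A' ⊆ A := hA' ▸ filter_subset _ _
  have hBB' : B' ⊆ B := hB' ▸ filter_subset _ _
  have hA₀A' : A₀ ⊆ A' := fun a ha => by
    rw [hA', mem_filter]; exact ⟨hA₀ ha, fun b hb => add_mem_add ha hb⟩
  have hB₀B' : B₀ ⊆ B' := fun b hb => by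
    rw [hB', mem_filter]
    refine ⟨hB₀ hb, fun a ha => ?_⟩
    rw [hA', mem_filter] at ha
    exact ha.2 b hb
  have hsum : A' + B' = D := by
    apply subset_antisymm _ (add_subset_add hA₀A' hB₀B')
    intro x hx
    obtain ⟨a, ha, b, hb, rfl⟩ := mem_add.1 hx
    rw [hB', mem_filter] at hb
    exact hb.2 a ha
  have hexA : ∀ a ∈ A \ A', ∃ b ∈ B', a + b ∉ D := by
    intro a ha
    rw [mem_sdiff, hA', mem_filter] at ha
    by_contra! hcon
    exact ha.2 ⟨ha.1, fun b hb => hcon b (hB₀B' hb)⟩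
  have hexB : ∀ b ∈ B \ B', ∃ a ∈ A', a + b ∉ D := by
    intro b hb
    rw [mem_sdiff, hB', mem_filter] at hb
    by_contra! hcon
    exact hb.2 ⟨hb.1, hcon⟩
  have hDne : D.Nonempty := hA₀ne.add hB₀ne
  have hS := isFinSubgroup_finStab hDne
  have hkn := kneser (hA₀ne.mono hA₀A') (hB₀ne.mono hB₀B')
  rw [hsum] at hkn
  have hl1 := card_le_card (sdiff_subset_sdiff (le_refl A) hA₀A')
  have hl2 := card_le_card (sdiff_subset_sdiff (le_refl B) hB₀B')
  have hAc' := card_sdiff_add_card_eq_card hAA'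
  have hBc' := card_sdiff_add_card_eq_card hBB'
  -- the lower bound coming from a set of exceptional elements
  have bound : ∀ E ⊆ A \ A', ∀ F ⊆ B \ B', #E + #F ≤ t →
      (t * #D + ((#E + #F : ℕ) : ℤ) * (#(finStab D) -
        (holes (finStab D) A' + holes (finStab D) B')) : ℤ) ≤ truncSum t A B ∅ := by
    intro E hE F hF hle
    have hDs : D ⊆ A + B := add_subset_add hA₀ hB₀
    have h1 := card_add_card_mul_le_sum_rep (T := A + B) hS (add_finStab hDne)
      (fun a ha => hexA a (hE ha)) (fun b hb => hexB b (hF hb))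
      (add_subset_add (hE.trans sdiff_subset) hBB')
      (add_subset_add hAA' (hF.trans sdiff_subset))
    have h2 : t * #D ≤ ∑ g ∈ D, min t (rep A B g) := by
      rw [mul_comm, ← smul_eq_mul]
      apply card_nsmul_le_sum
      intro g hg
      obtain ⟨a, ha, b, hb, rfl⟩ := mem_add.1 hg
      exact le_min le_rfl (hpop a ha b hb)
    have h3 : ∑ g ∈ (A + B) \ D, (rep E B' g + rep A' F g) ≤
        ∑ g ∈ (A + B) \ D, min t (rep A B g) := by
      apply sum_le_sum
      intro g _
      have h4 := rep_add_rep_add_rep_le hAA' hBB' hE hF g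
      have h5 := rep_add_rep_le_card_add_card A' B' E F g
      omega
    rw [← Nat.cast_sum] at h1
    rw [truncSum_empty_eq le_rfl, ← sum_sdiff hDs]
    zify at h2 h3 ⊢
    push_cast at h1
    linarith
  have hkn' : (#A' + #B' : ℤ) + (holes (finStab D) A' + holes (finStab D) B') ≤
      #D + #(finStab D) := by
    unfold holes
    omega
  have hlt' : #(A \ A') + #(B \ B') < t := by
    by_contra! hge
    -- Exactly t exceptional elements fill the truncation without overflow, and with Kneser they
    -- give N ≥ t(|A'| + |B'|), exceeding the assumed bound since fewer than 2t elements are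
    -- missing.
    obtain ⟨E, hE, F, hF, hEF⟩ : ∃ E ⊆ A \ A', ∃ F ⊆ B \ B', #E + #F = t := by
      rcases le_total t #(A \ A') with h | h
      · obtain ⟨E, hE, hc⟩ := exists_subset_card_eq h
        exact ⟨E, hE, ∅, empty_subset _, by simpa using hc⟩
      · obtain ⟨F, hF, hc⟩ := exists_subset_card_eq (s := B \ B') (n := t - #(A \ A'))
          (by omega)
        exact ⟨_, le_rfl, F, hF, by omega⟩
    have h1 := bound E hE F hF hEF.le
    rw [hEF] at h1
    have h2 : (#A + #B : ℤ) < #A' + #B' + 2 * t := by omega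
    have ht' : (0 : ℤ) < t := by exact_mod_cast ht
    nlinarith
  refine ⟨A', B', hAA', hBB', hA₀ne.mono hA₀A', hB₀ne.mono hB₀B', hlt', ?_, by rwa [hsum],
    by rwa [hsum]⟩
  rw [hsum]
  have h1 := bound _ le_rfl _ le_rfl hlt'.le
  have h2 : (#A + #B : ℤ) = #A' + #B' + ((#(A \ A') + #(B \ B') : ℕ) : ℤ) := by omega
  set l := #(A \ A') + #(B \ B') with hl
  set ρ := holes (finStab D) A' + holes (finStab D) B' with hρ
  -- With all l < t exceptional elements, Kneser gives (t − l)(|H| − ρ) ≥ 2t² − tl, and l ≥ 0 leaves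
  -- 2t(t − l).
  have h3 : ((t : ℤ) - l) * (2 * t) ≤ (t - l) * (#(finStab D) - ρ) := by
    have h4 : (t : ℤ) * (#A' + #B' + ρ) ≤ t * (#D + #(finStab D)) := by gcongr
    have h5 : (0 : ℤ) ≤ t * l := by positivity
    rw [h2] at hN
    nlinarith
  have h6 := le_of_mul_le_mul_left h3 (by omega)
  omega

end Structured

/-! ### Descent through subgroups towards a popular core. -/

section Descent

theorem card_sdiff_sdiff_le {α : Type*} [DecidableEq α] (A B C : Finset α) : #(A \ (B \ C)) ≤ #(A \ B) + #C := by
  refine (card_le_card ?_).trans (card_union_le _ _)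
  intro x
  simp only [mem_sdiff, mem_union]
  tauto

variable {G : Type*} [AddCommGroup G] [DecidableEq G]

/-- After removing fewer than `2 * t` elements, all sums of `A` and `B` are `t`-representable. -/
def HasPopularCore (t : ℕ) (A B : Finset G) : Prop :=
  ∃ A₀ ⊆ A, ∃ B₀ ⊆ B, #(A \ A₀) + #(B \ B₀) < 2 * t ∧
    ∀ a ∈ A₀, ∀ b ∈ B₀, t ≤ rep A B (a + b)

/-- A `K`-periodic set `D` of `t`-representable elements of `A + B` such that, up to removing
`2 * (t - s)` elements, the sums outside of `D` come from `P + Q` and have few representations. -/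
structure DescentState (t : ℕ) (A B K D P Q : Finset G) (s : ℕ) : Prop where
  pos : 1 ≤ s
  le : s ≤ t
  isFinSubgroup : IsFinSubgroup K
  periodic : D + K = D
  le_rep : ∀ g ∈ D, t ≤ rep A B g
  subset_left : P ⊆ A
  subset_right : Q ⊆ B
  exists_core : ∃ A₁ ⊆ A, ∃ B₁ ⊆ B, #(A \ A₁) + #(B \ B₁) ≤ 2 * (t - s) ∧
    ∀ a ∈ A₁, ∀ b ∈ B₁, a + b ∉ D → a ∈ P ∧ b ∈ Q
  truncSum_le : (truncSum s P Q D : ℤ) ≤ s * (#K - holes K (P ∪ Q) - s) - t ^ 2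

/-- At most s exceptional elements are involved and E × F is left out, so nothing is counted twice
and truncation at s never bites. -/
theorem card_mul_le_truncSum {s : ℕ} {P Q E F D : Finset G} {c : ℕ}
    (hE : E ⊆ P) (hF : F ⊆ Q) (hs : #E + #F ≤ s)
    (hE' : ∀ a ∈ E, c ≤ #{b ∈ Q \ F | a + b ∉ D}) (hF' : ∀ b ∈ F, c ≤ #{a ∈ P \ E | a + b ∉ D}) :
    (#E + #F) * c ≤ truncSum s P Q D := by
  have h1 : #E * c ≤ ∑ g ∈ (P + Q) \ D, rep E (Q \ F) g := by
    rw [sum_rep, ← smul_eq_mul]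
    refine card_nsmul_le_sum _ _ _ fun a ha => (hE' a ha).trans (card_le_card fun b hb => ?_)
    simp only [mem_filter, mem_sdiff] at hb ⊢
    exact ⟨hb.1, add_mem_add (hE ha) hb.1.1, hb.2⟩
  have h2 : #F * c ≤ ∑ g ∈ (P + Q) \ D, rep (P \ E) F g := by
    simp_rw [rep_comm _ F]
    rw [sum_rep, ← smul_eq_mul]
    refine card_nsmul_le_sum _ _ _ fun b hb => (hF' b hb).trans (card_le_card fun a ha => ?_)
    simp only [mem_filter, mem_sdiff] at ha ⊢
    rw [add_comm b a]
    exact ⟨ha.1, add_mem_add ha.1.1 (hF hb), ha.2⟩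
  have h3 : (∑ g ∈ (P + Q) \ D, rep E (Q \ F) g) + (∑ g ∈ (P + Q) \ D, rep (P \ E) F g) ≤
      truncSum s P Q D := by
    rw [← sum_add_distrib]
    apply sum_le_sum
    intro g _
    have h4 := rep_add_rep_add_rep_le (A' := P \ E) (B' := Q \ F) (E := E) (F := F)
      sdiff_subset sdiff_subset (by rw [Finset.sdiff_sdiff_eq_self hE]) (by rw [Finset.sdiff_sdiff_eq_self hF]) g
    have h5 := rep_add_rep_le_card_add_card (P \ E) (Q \ F) E F g
    omega
  rw [add_mul]
  omega

namespace DescentState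

variable {t s : ℕ} {A B K D P Q : Finset G}

theorem two_mul_add_holes_le (h : DescentState t A B K D P Q s) :
    (2 * s + holes K (P ∪ Q) : ℤ) ≤ #K := by
  have h1 := h.truncSum_le
  have h2 : (s : ℤ) ≤ t := by exact_mod_cast h.le
  have h3 : (1 : ℤ) ≤ s := by exact_mod_cast h.pos
  have h4 : (s : ℤ) * s ≤ s * (#K - holes K (P ∪ Q) - s) := by nlinarith
  have := le_of_mul_le_mul_left h4 (by omega)
  omega

theorem add_notMem_of_sub_mem (h : DescentState t A B K D P Q s) {a b a' b' : G}
    (hab : a + b ∉ D) (ha : a' - b ∈ K) (hb : b' - a ∈ K) : a' + b' ∉ D := by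
  intro hD
  refine hab ((h.isFinSubgroup.mem_iff_of_periodic h.periodic ?_).1 hD)
  have := h.isFinSubgroup.neg_mem (h.isFinSubgroup.add_mem ha hb)
  convert this using 1; abel

/-- If b + K also held s elements of P, the swapped crossing of the two cosets would be a large pair
off D. So Q alone nearly fills b + K. -/
theorem card_lt_of_no_large_pair (h : DescentState t A B K D P Q s)
    (hno : ∀ a ∈ P, ∀ b ∈ Q, a + b ∉ D → s ≤ #(cosetPart K a P) → #(cosetPart K b Q) < s)
    {a b : G} (ha : a ∈ P) (hb : b ∈ Q) (hab : a + b ∉ D) (hlt : #(cosetPart K a P) < s) :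
    (#K - holes K (P ∪ Q) - s : ℤ) < #(cosetPart K b Q) ∧ s ≤ #(cosetPart K b Q) := by
  have h0 := h.two_mul_add_holes_le
  have h1 := h.isFinSubgroup.card_le_cosetPart_add_holes (mem_union_left Q ha)
  have h2 := h.isFinSubgroup.card_le_cosetPart_add_holes (mem_union_right P hb)
  have h3 := card_cosetPart_union_le K a P Q
  have h4 := card_cosetPart_union_le K b P Q
  have hpos := h.pos
  by_cases hbP : #(cosetPart K b P) < s
  · omega
  · exfalso
    obtain ⟨a', ha'⟩ : (cosetPart K b P).Nonempty := card_pos.1 (by omega)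
    obtain ⟨b', hb'⟩ : (cosetPart K a Q).Nonempty := card_pos.1 (by omega)
    rw [mem_cosetPart] at ha' hb'
    have := hno a' ha'.1 b' hb'.1 (h.add_notMem_of_sub_mem hab ha'.2 hb'.2)
      (by rw [← h.isFinSubgroup.cosetPart_congr ha'.2]; omega)
    rw [← h.isFinSubgroup.cosetPart_congr hb'.2] at this
    omega

theorem symm (h : DescentState t A B K D P Q s) : DescentState t B A K D Q P s where
  pos := h.pos
  le := h.le
  isFinSubgroup := h.isFinSubgroup
  periodic := h.periodic
  le_rep g hg := by rw [rep_comm]; exact h.le_rep g hg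
  subset_left := h.subset_right
  subset_right := h.subset_left
  exists_core := by
    obtain ⟨A₁, hA₁, B₁, hB₁, hc, hs⟩ := h.exists_core
    refine ⟨B₁, hB₁, A₁, hA₁, by omega, fun b hb a ha hab => ?_⟩
    exact (hs a ha b hb (by rwa [add_comm])).symm
  truncSum_le := by rw [truncSum_comm, union_comm]; exact h.truncSum_le

/-- Every sum off D has a factor in E or F, a small coset part facing a nearly full one. If |E| +
|F| ≥ s, then s such elements would contribute more than `truncSum_le` allows. Deleting E and F
costs at most s − 1 beyond the 2(t − s) already removed. -/
theorem hasPopularCore_of_no_large_pair (h : DescentState t A B K D P Q s)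
    (hno : ∀ a ∈ P, ∀ b ∈ Q, a + b ∉ D → s ≤ #(cosetPart K a P) → #(cosetPart K b Q) < s) :
    HasPopularCore t A B := by
  have hK := h.isFinSubgroup
  have hpos := h.pos
  have hle := h.le
  set c : ℤ := #K - holes K (P ∪ Q) - s + 1 with hc
  have hc0 : 0 ≤ c := by have := h.two_mul_add_holes_le; omega
  obtain ⟨c', hc'⟩ := Int.eq_ofNat_of_zero_le hc0
  have keyP : ∀ a ∈ P, ∀ b ∈ Q, a + b ∉ D → #(cosetPart K a P) < s →
      c' ≤ #(cosetPart K b Q) ∧ s ≤ #(cosetPart K b Q) := by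
    intro a ha b hb hab hlt
    have := h.card_lt_of_no_large_pair hno ha hb hab hlt
    omega
  have keyQ : ∀ a ∈ P, ∀ b ∈ Q, a + b ∉ D → #(cosetPart K b Q) < s →
      c' ≤ #(cosetPart K a P) ∧ s ≤ #(cosetPart K a P) := by
    intro a ha b hb hab hlt
    have := h.symm.card_lt_of_no_large_pair (fun b hb a ha hba hb' => by
      by_contra! hcon
      have := hno a ha b hb (by rwa [add_comm]) hcon
      omega) hb ha (by rwa [add_comm]) hlt
    rw [union_comm] at this
    omega
  set E : Finset G := {a ∈ P | #(cosetPart K a P) < s ∧ ∃ b ∈ Q, a + b ∉ D} with hE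
  set F : Finset G := {b ∈ Q | #(cosetPart K b Q) < s ∧ ∃ a ∈ P, a + b ∉ D} with hF
  have hEF : #E + #F < s := by
    by_contra! hge
    obtain ⟨E₁, hE₁, F₁, hF₁, hs⟩ : ∃ E₁ ⊆ E, ∃ F₁ ⊆ F, #E₁ + #F₁ = s := by
      rcases le_total s #E with h | h
      · obtain ⟨E', hE', hc⟩ := exists_subset_card_eq h
        exact ⟨E', hE', ∅, empty_subset _, by simpa using hc⟩
      · obtain ⟨F', hF', hc⟩ := exists_subset_card_eq (s := F) (n := s - #E) (by omega)
        exact ⟨_, le_rfl, F', hF', by omega⟩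
    have h1 : (#E₁ + #F₁) * c' ≤ truncSum s P Q D := by
      refine card_mul_le_truncSum (hE₁.trans (filter_subset _ _)) (hF₁.trans (filter_subset _ _))
        hs.le ?_ ?_
      · intro a ha
        have := hE₁ ha
        rw [hE, mem_filter] at this
        obtain ⟨haP, hlt, b, hb, hab⟩ := this
        have h2 := keyP a haP b hb hab hlt
        refine h2.1.trans (card_le_card fun x hx => ?_)
        rw [mem_cosetPart] at hx
        rw [mem_filter, mem_sdiff]
        refine ⟨⟨hx.1, fun hxF => ?_⟩, fun hxD => hab ?_⟩
        · have := hF₁ hxF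
          rw [hF, mem_filter, ← hK.cosetPart_congr hx.2] at this
          omega
        · exact (hK.mem_iff_of_periodic h.periodic (by simpa using hx.2)).2 hxD
      · intro b hb
        have := hF₁ hb
        rw [hF, mem_filter] at this
        obtain ⟨hbQ, hlt, a, ha, hab⟩ := this
        have h2 := keyQ a ha b hbQ hab hlt
        refine h2.1.trans (card_le_card fun x hx => ?_)
        rw [mem_cosetPart] at hx
        rw [mem_filter, mem_sdiff]
        refine ⟨⟨hx.1, fun hxE => ?_⟩, fun hxD => hab ?_⟩
        · have := hE₁ hxE
          rw [hE, mem_filter, ← hK.cosetPart_congr hx.2] at this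
          omega
        · exact (hK.mem_iff_of_periodic h.periodic (by simpa using hx.2)).2 hxD
    rw [hs] at h1
    zify at h1
    have h2 := h.truncSum_le
    have h3 : (#K - holes K (P ∪ Q) - s : ℤ) = c' - 1 := by omega
    rw [h3] at h2
    have h4 : (1 : ℤ) ≤ s := by exact_mod_cast hpos
    nlinarith [sq_nonneg (t : ℤ)]
  obtain ⟨A₁, hA₁, B₁, hB₁, hcard, hcore⟩ := h.exists_core
  refine ⟨A₁ \ E, sdiff_subset.trans hA₁, B₁ \ F, sdiff_subset.trans hB₁, ?_, ?_⟩
  · have := card_sdiff_sdiff_le A A₁ E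
    have := card_sdiff_sdiff_le B B₁ F
    omega
  · intro a ha b hb
    rw [mem_sdiff] at ha hb
    by_contra hcon
    have hab : a + b ∉ D := fun hD => hcon (h.le_rep _ hD)
    obtain ⟨haP, hbQ⟩ := hcore a ha.1 b hb.1 hab
    have haE : ¬ #(cosetPart K a P) < s := fun hlt =>
      ha.2 (mem_filter.2 ⟨haP, hlt, b, hbQ, hab⟩)
    have hbF : ¬ #(cosetPart K b Q) < s := fun hlt =>
      hb.2 (mem_filter.2 ⟨hbQ, hlt, a, haP, hab⟩)
    have := hno a haP b hbQ hab
    omega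

/-- A representation counted in both pairs would have its terms in X' and Y'. -/
theorem rep_add_rep_le_of_notMem {X Y X' Y' : Finset G} (hX : X ⊆ P) (hY : Y ⊆ Q)
    {g : G} (hg : g ∉ X' + Y') :
    rep X Y g + rep (P \ (X \ X')) (Q \ (Y \ Y')) g ≤ rep P Q g := by
  unfold rep
  rw [← card_union_of_disjoint]
  · apply card_le_card
    intro a
    simp only [mem_union, mem_filter, mem_sdiff]
    rintro (ha | ha)
    · exact ⟨hX ha.1, hY ha.2⟩
    · exact ⟨ha.1.1, ha.2.1⟩
  · rw [disjoint_left]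
    intro a ha ha'
    simp only [mem_filter, mem_sdiff, not_and, not_not] at ha ha'
    apply hg
    have := add_mem_add (ha'.1.2 ha.1) (ha'.2.2 ha.2)
    simpa using this

theorem le_truncSum_of_structured {X Y X' Y' : Finset G} (hX : X ⊆ P) (hY : Y ⊆ Q)
    (hdis : Disjoint (X + Y) D) (hst : Structured s X Y X' Y') :
    (s * #(X' + Y') + ((#(X \ X') + #(Y \ Y') : ℕ) : ℤ) * (#(finStab (X' + Y')) -
      (holes (finStab (X' + Y')) X' + holes (finStab (X' + Y')) Y')) +
      truncSum (s - (#(X \ X') + #(Y \ Y'))) (P \ (X \ X')) (Q \ (Y \ Y')) (D ∪ (X' + Y')) : ℤ) ≤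
      truncSum s P Q D := by
  have hT : X + Y ⊆ (P + Q) \ D := by
    rw [subset_sdiff]; exact ⟨add_subset_add hX hY, hdis⟩
  have h1 := hst.sum_min_le
    (fun g => if g ∈ X' + Y' then 0 else rep (P \ (X \ X')) (Q \ (Y \ Y')) g) hT
  have h2 : ∑ g ∈ (P + Q) \ D, min s (rep X Y g + if g ∈ X' + Y' then 0 else
      rep (P \ (X \ X')) (Q \ (Y \ Y')) g) ≤ truncSum s P Q D := by
    apply sum_le_sum
    intro g _
    apply min_le_min le_rfl
    split_ifs with hg
    · exact rep_mono hX hY g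
    · exact rep_add_rep_le_of_notMem hX hY hg
  have h3 : truncSum (s - (#(X \ X') + #(Y \ Y'))) (P \ (X \ X')) (Q \ (Y \ Y')) (D ∪ (X' + Y')) =
      ∑ g ∈ ((P + Q) \ D) \ (X' + Y'), min (s - (#(X \ X') + #(Y \ Y')))
        (if g ∈ X' + Y' then 0 else rep (P \ (X \ X')) (Q \ (Y \ Y')) g) := by
    rw [truncSum_eq (add_subset_add sdiff_subset sdiff_subset : _ ⊆ P + Q), sdiff_sdiff_left]
    apply sum_congr rfl
    intro g hg
    simp only [mem_sdiff, mem_union, not_or] at hg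
    rw [if_neg hg.2.2]
  rw [h3]
  exact h1.trans (by exact_mod_cast h2)

/-- The t² reserve in `DescentState.truncSum_le` is what makes new sums t-popular for the original
t, although the structure was obtained only for s ≤ t. -/
theorem le_sub_of_descent {s t l k k' σ x ρ f N : ℤ} (hs : 1 ≤ s) (hst : s ≤ t) (hl : 0 ≤ l)
    (hls : l < s) (hN : s * f + l * (k' - ρ) + N ≤ s * (k - σ - s) - t ^ 2) (hN0 : 0 ≤ N)
    (hf : x - l + ρ ≤ f + k') (hx : k - σ ≤ x) : t ≤ k' - ρ := by
  have h1 : s * (k - σ - l + ρ - k') ≤ s * f := mul_le_mul_of_nonneg_left (by omega) (by omega)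
  have h2 : s * (s - l) + t ^ 2 ≤ (s - l) * (k' - ρ) := by nlinarith
  by_contra! hlt
  have h3 : (s - l) * (k' - ρ) ≤ (s - l) * t := mul_le_mul_of_nonneg_left (by omega) (by omega)
  have h4 : (s - l) * t ≤ t * t := mul_le_mul_of_nonneg_right (by omega) (by omega)
  have h5 : 1 ≤ s * (s - l) := by nlinarith
  nlinarith

/-- The invariant is reproduced with s − l for s and the same reserve t². Here k, σ and k', σ' are
order and holes before and after, x = |X| + |Y| and f = |X' + Y'|. -/
theorem bound_of_descent {s t l k k' σ σ' x ρ f N : ℤ} (hl : 0 ≤ l)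
    (hls : l < s) (hN : s * f + l * (k' - ρ) + N ≤ s * (k - σ - s) - t ^ 2)
    (hf : x - l + ρ ≤ f + k') (hx : k - σ ≤ x)
    (hσ : σ' ≤ σ + l - max 0 (k - (x - l + ρ))) :
    N ≤ (s - l) * (k' - σ' - (s - l)) - t ^ 2 := by
  have h1 : s * (x - l + ρ - k') ≤ s * f := mul_le_mul_of_nonneg_left (by omega) (by omega)
  have h2 : (s - l) * σ' ≤ (s - l) * (σ + l - (k - (x - l + ρ))) :=
    mul_le_mul_of_nonneg_left (by omega) (by omega)
  have h3 : l * (k - σ) ≤ l * x := mul_le_mul_of_nonneg_left hx hl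
  nlinarith

theorem false_of_descent {s t l k k' σ x ρ f N : ℤ} (hs : 1 ≤ s) (hl : 0 ≤ l)
    (hN : s * f + l * (k' - ρ) + N ≤ s * (k - σ - s) - t ^ 2) (hN0 : 0 ≤ N) (hρ : 0 ≤ ρ)
    (hk' : 2 * s ≤ k' - ρ)
    (hf : x - l + ρ ≤ f + k') (hx : 2 * k ≤ 2 * x + σ)
    (hm : k' ≤ k - (x - l + ρ)) : False := by
  have h1 : s * (x - l + ρ - k') ≤ s * f := mul_le_mul_of_nonneg_left (by omega) (by omega)
  have h2 : s * (k' + k - (x - l + ρ)) ≤ s * (σ + 2 * l) :=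
    mul_le_mul_of_nonneg_left (by omega) (by omega)
  have h3 : l * (2 * s) ≤ l * (k' - ρ) := mul_le_mul_of_nonneg_left hk' hl
  nlinarith

-- One descent step. Since |X| + |Y| ≥ |K| − holes and s ≤ t, the budget on P + Q off D bounds the
-- truncated sum of X, Y by s(|X| + |Y|) − 2s², so the pair can be structured. The l elements of X \
-- X' and Y \ Y' are discarded and s becomes s − l.
set_option maxHeartbeats 2000000 in
theorem exists_of_large_pair (h : DescentState t A B K D P Q s)
    (ih : ∀ X Y : Finset G, s ≤ #X → s ≤ #Y → #Y ≤ #Q →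
      (truncSum s X Y ∅ : ℤ) ≤ s * (#X + #Y) - 2 * s ^ 2 → ∃ X' Y', Structured s X Y X' Y')
    {a b : G} (ha : a ∈ P) (hab : a + b ∉ D) (hX : s ≤ #(cosetPart K a P))
    (hY : s ≤ #(cosetPart K b Q)) (hor : a - b ∈ K ∨ (2 * #K : ℤ) ≤
      2 * (#(cosetPart K a P) + #(cosetPart K b Q)) + holes K (P ∪ Q)) :
    ∃ K' D' P' Q' s', #K' < #K ∧ #Q' ≤ #Q ∧ DescentState t A B K' D' P' Q' s' := by
  have hK := h.isFinSubgroup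
  have hpos := h.pos
  have hle := h.le
  have hσ := hK.holes_nonneg (P ∪ Q)
  have hpos' : (1 : ℤ) ≤ s := by exact_mod_cast hpos
  have hle' : (s : ℤ) ≤ t := by exact_mod_cast hle
  have hXP := cosetPart_subset K a P
  have hYQ := cosetPart_subset K b Q
  set X := cosetPart K a P with hXdef
  set Y := cosetPart K b Q with hYdef
  have hXs : ∀ x ∈ X, x - a ∈ K := fun x hx => (mem_cosetPart.1 hx).2
  have hYs : ∀ x ∈ Y, x - b ∈ K := fun x hx => (mem_cosetPart.1 hx).2
  have hdis := hK.disjoint_coset h.periodic hab (hK.add_subset_coset hXs hYs)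
  have haW : a ∈ P ∪ Q := mem_union_left _ ha
  have hZ : a - b ∈ K → cosetPart K a (P ∪ Q) ⊆ X ∪ Y := by
    intro hor
    rw [cosetPart_union, hYdef, hK.cosetPart_congr (a := b) hor]
  have hx : (#K - holes K (P ∪ Q) : ℤ) ≤ #X + #Y := by
    rcases hor with hor | hor
    · have h1 := hK.card_le_cosetPart_add_holes haW
      have h2 := (card_le_card (hZ hor)).trans (card_union_le _ _)
      omega
    · omega
  have hXY : truncSum s X Y ∅ ≤ truncSum s P Q D := by
    rw [← truncSum_eq_of_disjoint hdis]
    exact truncSum_mono hXP hYQ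
  have hbound := h.truncSum_le
  obtain ⟨X', Y', hst⟩ := ih X Y hX hY (card_le_card hYQ) (by
    zify at hXY
    nlinarith [mul_le_mul_of_nonneg_left hx (by omega : (0 : ℤ) ≤ s)])
  have hlow := (le_truncSum_of_structured hXP hYQ hdis hst).trans hbound
  have hH := hst.isFinSubgroup
  have hper := hst.periodic
  have hkn := hst.card_add_card_add_holes_le
  have h2s := hst.two_mul_le
  have hlt := hst.lt
  have hX'c := card_sdiff_add_card_eq_card hst.subset_left
  have hY'c := card_sdiff_add_card_eq_card hst.subset_right
  have hFne := hst.nonempty_left.add hst.nonempty_right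
  have hFle := IsFinSubgroup.card_le_of_periodic hFne hper
  have hFs : X' + Y' ⊆ X + Y := add_subset_add hst.subset_left hst.subset_right
  have hrep : ∀ g ∈ X' + Y', (#(finStab (X' + Y')) - (holes (finStab (X' + Y')) X' +
      holes (finStab (X' + Y')) Y') : ℤ) ≤ rep A B g := by
    intro g hg
    have h1 := hH.card_sub_holes_le_rep hg
    have h2 := rep_mono (hst.subset_left.trans (hXP.trans h.subset_left))
      (hst.subset_right.trans (hYQ.trans h.subset_right)) g
    omega
  have hHK : finStab (X' + Y') ⊆ K := hK.subset_of_periodic_coset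
    (fun x hx => hK.add_subset_coset hXs hYs x (hFs hx)) hFne hper
  have hdvd : #(finStab (X' + Y')) ∣ #K := by
    have := hH.card_dvd K
    rwa [hK.add_of_subset hH hHK] at this
  have hdvd' : #(finStab (X' + Y')) ∣ #(X' + finStab (X' + Y')) + #(Y' + finStab (X' + Y')) :=
    dvd_add (hH.card_dvd X') (hH.card_dvd Y')
  have hm : (#(X' + finStab (X' + Y')) + #(Y' + finStab (X' + Y')) : ℤ) =
      #X' + #Y' + (holes (finStab (X' + Y')) X' + holes (finStab (X' + Y')) Y') := by
    unfold holes; ring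
  have hρ : 0 ≤ holes (finStab (X' + Y')) X' + holes (finStab (X' + Y')) Y' :=
    add_nonneg (hH.holes_nonneg _) (hH.holes_nonneg _)
  set H := finStab (X' + Y') with hHdef
  set ρ := holes H X' + holes H Y' with hρdef
  set l := #(X \ X') + #(Y \ Y') with hl
  set P' := P \ (X \ X') with hP'
  set Q' := Q \ (Y \ Y') with hQ'
  have hl' : (l : ℤ) < s := by exact_mod_cast hlt
  have hl0 : (0 : ℤ) ≤ l := Int.natCast_nonneg _
  have hxl : (#X' + #Y' : ℤ) = #X + #Y - l := by omega
  have hN0 : (0 : ℤ) ≤ truncSum (s - l) P' Q' (D ∪ (X' + Y')) := Int.natCast_nonneg _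
  rw [hxl] at hkn hm
  have hWc : (#(P ∪ Q) : ℤ) - #(P' ∪ Q') ≤ l := by
    have h1 : P ∪ Q ⊆ (P' ∪ Q') ∪ ((X \ X') ∪ (Y \ Y')) := by
      intro x
      simp only [hP', hQ', mem_union, mem_sdiff]
      tauto
    have h2 := (card_le_card h1).trans ((card_union_le _ _).trans
      (Nat.add_le_add_left (card_union_le _ _) _))
    omega
  have hWs : P' ∪ Q' ⊆ P ∪ Q := union_subset_union sdiff_subset sdiff_subset
  have hHlt : #H < #K := by
    by_contra hcon
    have hHK' : #H = #K := le_antisymm (card_le_card hHK) (by omega)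
    have h1 : (s : ℤ) * #K ≤ s * #(X' + Y') :=
      mul_le_mul_of_nonneg_left (by exact_mod_cast hHK' ▸ hFle) (by omega)
    have h2 : 0 ≤ (l : ℤ) * (#H - ρ) := mul_nonneg hl0 (by omega)
    nlinarith [mul_nonneg (by omega : (0 : ℤ) ≤ s) hσ]
  have hholes : holes H (P' ∪ Q') ≤
      holes K (P ∪ Q) + l - max 0 (#K - ((#X + #Y : ℤ) - l + ρ)) := by
    rcases le_or_gt (#K) (#(X' + H) + #(Y' + H)) with hmk | hmk
    · have := holes_le_of_subset hHK hWs
      rw [max_eq_left (by omega)]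
      omega
    · rcases hor with hor | hor
      · have hZ' : cosetPart K a (P' ∪ Q') ⊆ X' ∪ Y' := by
          intro z hz
          rw [mem_cosetPart, mem_union] at hz
          have hzXY := hZ hor (mem_cosetPart.2 ⟨hWs (mem_union.2 hz.1), hz.2⟩)
          have hzX : z ∈ P → z ∈ X := fun hzP => mem_cosetPart.2 ⟨hzP, hz.2⟩
          have hzY : z ∈ Q → z ∈ Y := fun hzQ => by
            rw [hYdef, hK.cosetPart_congr (a := b) hor]
            exact mem_cosetPart.2 ⟨hzQ, hz.2⟩
          rcases hz.1 with hzP | hzQ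
          · rw [hP', mem_sdiff, mem_sdiff] at hzP
            have := hzX hzP.1
            rw [mem_union]; tauto
          · rw [hQ', mem_sdiff, mem_sdiff] at hzQ
            have := hzY hzQ.1
            rw [mem_union]; tauto
        have h1 := holes_le_of_cosetPart hK hHK hWs haW hZ'
        have h2 := card_union_le (X' + H) (Y' + H)
        rw [← union_add] at h2
        rw [max_eq_right (by omega)]
        omega
      -- As in Kneser's descent, divisibility makes the deficit at least |H|, which the budget does
      -- not permit.
      · exfalso
        have h3 := Nat.le_of_dvd (by omega) (Nat.dvd_sub hdvd hdvd')
        have h4 : (#H : ℤ) ≤ #K - ((#X + #Y : ℤ) - l + ρ) := by omega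
        exact false_of_descent hpos' hl0 hlow hN0 hρ (by omega) hkn
          (by linarith) h4
  have hHt : (t : ℤ) ≤ #H - ρ :=
    le_sub_of_descent hpos' hle' hl0 hl' hlow hN0 hkn hx
  refine ⟨H, D ∪ (X' + Y'), P', Q', s - l, hHlt, card_le_card sdiff_subset, ?_⟩
  obtain ⟨A₁, hA₁, B₁, hB₁, hcard, hcore⟩ := h.exists_core
  refine ⟨by omega, by omega, hH, ?_, ?_, sdiff_subset.trans h.subset_left,
    sdiff_subset.trans h.subset_right, ⟨A₁ \ (X \ X'), sdiff_subset.trans hA₁, B₁ \ (Y \ Y'),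
      sdiff_subset.trans hB₁, ?_, ?_⟩, ?_⟩
  · rw [union_add, hper]
    congr 1
    conv_lhs => rw [← h.periodic, add_assoc, hK.add_of_subset hH hHK, h.periodic]
  · intro g hg
    rcases mem_union.1 hg with hg | hg
    · exact h.le_rep g hg
    · have := hrep g hg
      omega
  · have := card_sdiff_sdiff_le A A₁ (X \ X')
    have := card_sdiff_sdiff_le B B₁ (Y \ Y')
    omega
  · intro a ha b hb hab
    rw [mem_sdiff] at ha hb
    rw [mem_union, not_or] at hab
    have := hcore a ha.1 b hb.1 hab.1
    exact ⟨mem_sdiff.2 ⟨this.1, ha.2⟩, mem_sdiff.2 ⟨this.2, hb.2⟩⟩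
  · rw [Nat.cast_sub hlt.le]
    exact bound_of_descent hl0 hl' hlow hkn hx hholes

theorem hasPopularCore (n : ℕ) : ∀ {K D P Q : Finset G} {s : ℕ}, #K ≤ n →
    DescentState t A B K D P Q s →
    (∀ (s : ℕ) (X Y : Finset G), 1 ≤ s → s ≤ #X → s ≤ #Y → #Y ≤ #Q →
      (truncSum s X Y ∅ : ℤ) ≤ s * (#X + #Y) - 2 * s ^ 2 → ∃ X' Y', Structured s X Y X' Y') →
    HasPopularCore t A B := by
  induction n with
  | zero =>
    intro K D P Q s hn h
    have := h.isFinSubgroup.card_pos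
    omega
  | succ n ihn =>
    intro K D P Q s hn h ih
    by_cases hno : ∀ a ∈ P, ∀ b ∈ Q, a + b ∉ D → s ≤ #(cosetPart K a P) →
      #(cosetPart K b Q) < s
    · exact h.hasPopularCore_of_no_large_pair hno
    push Not at hno
    obtain ⟨a, ha, b, hb, hab, hX, hY⟩ := hno
    have hK := h.isFinSubgroup
    have next : (∃ K' D' P' Q' s', #K' < #K ∧ #Q' ≤ #Q ∧ DescentState t A B K' D' P' Q' s') →
        HasPopularCore t A B := by
      rintro ⟨K', D', P', Q', s', hlt, hQ, h'⟩
      exact ihn (by omega) h' fun s X Y hs hsX hsY hYQ =>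
        ih s X Y hs hsX hsY (hYQ.trans hQ)
    apply next
    by_cases hor : a - b ∈ K
    · exact h.exists_of_large_pair (fun X Y => ih s X Y h.pos) ha hab hX hY (Or.inl hor)
    by_cases ho : (2 * #K : ℤ) ≤
        2 * (#(cosetPart K a P) + #(cosetPart K b Q)) + holes K (P ∪ Q)
    · exact h.exists_of_large_pair (fun X Y => ih s X Y h.pos) ha hab hX hY (Or.inr ho)
    have haW : a ∈ P ∪ Q := mem_union_left _ ha
    have hbW : b ∈ P ∪ Q := mem_union_right _ hb
    have h1 := hK.card_le_cosetPart_add_holes haW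
    have h1' := hK.card_le_cosetPart_add_holes hbW
    have h2 := hK.two_mul_card_le_cosetPart_add_holes haW hbW hor
    have h3 := card_cosetPart_union_le K a P Q
    have h4 := card_cosetPart_union_le K b P Q
    have hdis : Disjoint (cosetPart K a P + cosetPart K b Q) D :=
      hK.disjoint_coset h.periodic hab (hK.add_subset_coset
        (fun x hx => (mem_cosetPart.1 hx).2) (fun x hx => (mem_cosetPart.1 hx).2))
    have hXY : truncSum s (cosetPart K a P) (cosetPart K b Q) ∅ ≤ truncSum s P Q D := by
      rw [← truncSum_eq_of_disjoint hdis]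
      exact truncSum_mono (cosetPart_subset _ _ _) (cosetPart_subset _ _ _)
    have h5 := mul_card_le_truncSum (B := cosetPart K b Q) hX
    have h6 := mul_card_le_truncSum (B := cosetPart K a P) hY
    rw [truncSum_comm] at h6
    have h7 := h.truncSum_le
    have hpos := h.pos
    -- These upper bounds force the other set to have at least s elements in each of the two cosets,
    -- so the swapped crossing is again a large pair.
    have h8 : (#(cosetPart K b Q) : ℤ) ≤ #K - holes K (P ∪ Q) - s := by
      refine le_of_mul_le_mul_left (a := (s : ℤ)) ?_ (by omega)
      zify at h5 hXY
      nlinarith [sq_nonneg (t : ℤ)]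
    have h9 : (#(cosetPart K a P) : ℤ) ≤ #K - holes K (P ∪ Q) - s := by
      refine le_of_mul_le_mul_left (a := (s : ℤ)) ?_ (by omega)
      zify at h6 hXY
      nlinarith [sq_nonneg (t : ℤ)]
    obtain ⟨a', ha'⟩ : (cosetPart K b P).Nonempty := card_pos.1 (by omega)
    obtain ⟨b', hb'⟩ : (cosetPart K a Q).Nonempty := card_pos.1 (by omega)
    rw [mem_cosetPart] at ha' hb'
    have e1 := hK.cosetPart_congr ha'.2 P
    have e2 := hK.cosetPart_congr hb'.2 Q
    refine h.exists_of_large_pair (fun X Y => ih s X Y h.pos) ha'.1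
      (h.add_notMem_of_sub_mem hab ha'.2 hb'.2) (by rw [← e1]; omega) (by rw [← e2]; omega)
      (Or.inr ?_)
    rw [← e1, ← e2]
    omega

end DescentState

end Descent

/-! ### Union-intersection transform, induction on |B|, and conclusion. -/

section Main

variable {G : Type*} [AddCommGroup G] [DecidableEq G]

theorem union_add_inter_subset (A B : Finset G) : (A ∪ B) + (A ∩ B) ⊆ A + B := by
  rw [union_add]
  apply union_subset (add_subset_add_left inter_subset_right)
  rw [add_comm]
  exact add_subset_add_right inter_subset_left

/-- No sum has more than |A ∩ B| representations from the union-intersection pair, so these count in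
full and t − |A ∩ B| remains for the residual pair. -/
theorem card_mul_add_truncSum_le {t : ℕ} {A B : Finset G} (hc : #(A ∩ B) ≤ t) :
    #(A ∩ B) * #(A ∪ B) + truncSum (t - #(A ∩ B)) (A \ (A ∩ B)) (B \ (A ∩ B)) ∅ ≤
      truncSum t A B ∅ := by
  rw [truncSum_empty_eq (le_refl (A + B)), mul_comm,
    truncSum_empty_eq (add_subset_add sdiff_subset sdiff_subset : _ ⊆ A + B),
    ← sum_rep_of_subset (union_add_inter_subset A B), ← sum_add_distrib]
  apply sum_le_sum
  intro g _
  rw [rep_union_inter A B]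
  have := rep_le_card_right (A ∪ B) (A ∩ B) g
  omega

theorem truncSum_union_inter_le (t : ℕ) (A B : Finset G) :
    truncSum t (A ∪ B) (A ∩ B) ∅ ≤ truncSum t A B ∅ := by
  rw [truncSum_empty_eq (le_refl (A + B)), truncSum_empty_eq (union_add_inter_subset A B)]
  apply sum_le_sum
  intro g _
  rw [rep_union_inter A B]
  omega

theorem hasPopularCore_of_small_inter {t : ℕ} {A B : Finset G} (hA : t ≤ #A)
    (hB : t ≤ #B) (hN : (truncSum t A B ∅ : ℤ) ≤ t * (#A + #B) - 2 * t ^ 2)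
    (ih : ∀ (s : ℕ) (X Y : Finset G), 1 ≤ s → s ≤ #X → s ≤ #Y → #Y < #B →
      (truncSum s X Y ∅ : ℤ) ≤ s * (#X + #Y) - 2 * s ^ 2 → ∃ X' Y', Structured s X Y X' Y')
    (hc : 1 ≤ #(A ∩ B)) (hct : #(A ∩ B) < t) : HasPopularCore t A B := by
  have h1 := card_mul_add_truncSum_le hct.le
  have hU := card_union_add_card_inter A B
  have hA0 := card_sdiff_add_card_eq_card (inter_subset_left : A ∩ B ⊆ A)
  have hB0 := card_sdiff_add_card_eq_card (inter_subset_right : A ∩ B ⊆ B)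
  have hAs : A \ (A ∩ B) ⊆ A := sdiff_subset
  have hBs : B \ (A ∩ B) ⊆ B := sdiff_subset
  generalize A \ (A ∩ B) = A0 at *
  generalize B \ (A ∩ B) = B0 at *
  generalize #(A ∩ B) = c at *
  obtain ⟨s, rfl⟩ := Nat.exists_eq_add_of_lt hct
  have hs : c + s + 1 - c = s + 1 := by omega
  rw [hs] at h1
  have hUc : (#(A ∪ B) : ℤ) = #A0 + #B0 + c := by omega
  have hAc : (#A : ℤ) = #A0 + c := by omega
  have hBc : (#B : ℤ) = #B0 + c := by omega
  zify at h1
  rw [hUc] at h1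
  rw [hAc, hBc] at hN
  push_cast at hN
  have hc' : (1 : ℤ) ≤ c := by exact_mod_cast hc
  have hs' : (0 : ℤ) ≤ s := Int.natCast_nonneg _
  obtain ⟨A', B', hst⟩ := ih (s + 1) A0 B0 (by omega) (by omega) (by omega) (by omega) (by
    push_cast
    nlinarith)
  have h2 := hst.le_truncSum
  have h3 := hst.card_add_card_add_holes_le
  have hlt := hst.lt
  have hA'c := card_sdiff_add_card_eq_card hst.subset_left
  have hB'c := card_sdiff_add_card_eq_card hst.subset_right
  have hAB : (#A' + #B' : ℤ) = #A0 + #B0 - (#(A0 \ A') + #(B0 \ B') : ℕ) := by omega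
  -- Here t = c + s + 1: the sums must be popular for the original t, not only for the reduced value
  -- s + 1 used in the induction.
  have hρ : (c + s + 1 : ℤ) ≤ #(finStab (A' + B')) -
      (holes (finStab (A' + B')) A' + holes (finStab (A' + B')) B') := by
    generalize holes (finStab (A' + B')) A' + holes (finStab (A' + B')) B' = ρ at *
    generalize (#(A0 \ A') + #(B0 \ B') : ℕ) = l at *
    generalize (#(finStab (A' + B')) : ℤ) = h at *
    rw [hAB] at h3
    push_cast at h2
    have h4 : ((s : ℤ) + 1) * (#A0 + #B0 - l + ρ) ≤ (s + 1) * (#(A' + B') + h) := by gcongr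
    by_contra! hcon
    have hl : (l : ℤ) ≤ s := by omega
    have hl0 : (0 : ℤ) ≤ l := Int.natCast_nonneg _
    have h5 : (s + 1 - l) * (h - ρ) ≤ (s + 1 - l) * (c + s : ℤ) :=
      mul_le_mul_of_nonneg_left (by omega) (by omega)
    have h6 : 0 ≤ (l : ℤ) * (c - 1) := mul_nonneg hl0 (by omega)
    have h7 : 0 ≤ (c : ℤ) * (s + 1) := mul_nonneg (by omega) (by omega)
    have h8 : 2 * (s + 1) ^ 2 + 2 * c * (s + 1) + c ^ 2 - (s + 1) * l ≤
        (s + 1 - l) * (h - ρ : ℤ) := by linarith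
    linarith [sq_nonneg (s + 1 : ℤ), sq_nonneg (c : ℤ)]
  refine ⟨A', hst.subset_left.trans hAs, B', hst.subset_right.trans hBs, ?_, ?_⟩
  · have := card_sdiff_add_card_eq_card (hst.subset_left.trans hAs)
    have := card_sdiff_add_card_eq_card (hst.subset_right.trans hBs)
    omega
  · intro a ha b hb
    have h4 := hst.isFinSubgroup.card_sub_holes_le_rep (add_mem_add ha hb)
    have h5 := rep_mono (hst.subset_left.trans hAs) (hst.subset_right.trans hBs) (a + b)
    omega

theorem holes_sdiff_le {H U C C' : Finset G} (hH : IsFinSubgroup H) :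
    holes H ((U \ C) \ (C' + H)) ≤ holes H U + #(C \ C') := by
  have h1 : (U \ C) \ (C' + H) + H ⊆ ((U \ C) \ (C' + H)) ∪ (((U + H) \ U) ∪ (C \ C')) := by
    intro x hx
    obtain ⟨y, hy, k, hk, rfl⟩ := mem_add.1 hx
    simp only [mem_sdiff, mem_union] at hy ⊢
    have h2 : y + k ∈ U + H := add_mem_add hy.1.1 hk
    have h3 : y + k ∉ C' + H := fun h => hy.2
      ((hH.mem_iff_of_periodic (hH.add_add_self C') (by simpa using hk)).2 h)
    have h4 : y + k ∉ C' := fun h => h3 (hH.subset_add C' h)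
    tauto
  have h2 := (card_le_card h1).trans ((card_union_le _ _).trans
    (Nat.add_le_add_left (card_union_le _ _) _))
  have h3 := card_sdiff_add_card_eq_card (hH.subset_add U)
  unfold holes
  omega

/-- The structure of (A ∪ B, A ∩ B) starts a descent with s = t − l. Of the 2t² in the hypothesis,
one t² becomes the descent's reserve. -/
theorem hasPopularCore_of_large_inter {t : ℕ} {A B : Finset G} (ht : 1 ≤ t)
    (hN : (truncSum t A B ∅ : ℤ) ≤ t * (#A + #B) - 2 * t ^ 2)
    (ih : ∀ (s : ℕ) (X Y : Finset G), 1 ≤ s → s ≤ #X → s ≤ #Y → #Y < #B →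
      (truncSum s X Y ∅ : ℤ) ≤ s * (#X + #Y) - 2 * s ^ 2 → ∃ X' Y', Structured s X Y X' Y')
    (hct : t ≤ #(A ∩ B)) (hcB : #(A ∩ B) < #B) : HasPopularCore t A B := by
  have hU := card_union_add_card_inter A B
  have hUC := union_add_inter_subset A B
  have hUC' := truncSum_union_inter_le t A B
  have hB0 := card_sdiff_add_card_eq_card (inter_subset_right : A ∩ B ⊆ B)
  have hCU := (inter_subset_left : A ∩ B ⊆ A).trans (subset_union_left : A ⊆ A ∪ B)
  have hCUc := card_le_card hCU
  have hrep := rep_union_inter A B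
  have hAU : A ⊆ A ∪ B := subset_union_left
  have hBU : B ⊆ A ∪ B := subset_union_right
  have hWU : A \ (A ∩ B) ∪ B \ (A ∩ B) = (A ∪ B) \ (A ∩ B) := (union_sdiff_distrib _ _ _).symm
  have hUAB : ∀ x ∈ A ∪ B, x ∈ A ∨ x ∈ B := fun x => mem_union.1
  generalize A ∩ B = C at *
  generalize A ∪ B = U at *
  have hUc : (#A + #B : ℤ) = #U + #C := by omega
  rw [hUc] at hN
  obtain ⟨U', C', hst⟩ := ih t U C ht (by omega) hct hcB (by
    zify at hUC'; omega)
  have hH := hst.isFinSubgroup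
  have hper := hst.periodic
  have hlow := hst.sum_min_le (rep (A \ C) (B \ C)) hUC
  have hkn := hst.card_add_card_add_holes_le
  have hlt := hst.lt
  have hU'c := card_sdiff_add_card_eq_card hst.subset_left
  have hC'c := card_sdiff_add_card_eq_card hst.subset_right
  have hD : ∀ x ∈ U', x ∈ C' + finStab (U' + C') → ∀ y ∈ U', x + y ∈ U' + C' := by
    intro x _ hxC y hy
    obtain ⟨c, hc, k, hk, rfl⟩ := mem_add.1 hxC
    rw [← hper]
    have := add_mem_add (add_mem_add hy hc) hk
    convert this using 1; abel
  have hle_rep : ∀ g ∈ U' + C', t ≤ rep A B g := by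
    intro g hg
    have h1 := hst.two_mul_le_rep hg
    have h2 := rep_mono hst.subset_left hst.subset_right g
    rw [hrep]
    omega
  have hsum : ∑ g ∈ A + B, min t (rep U C g + rep (A \ C) (B \ C) g) = truncSum t A B ∅ := by
    rw [truncSum_empty_eq le_rfl]
    exact sum_congr rfl fun g _ => by rw [hrep]
  rw [hsum] at hlow
  set H := finStab (U' + C') with hHdef
  have hσ := holes_sdiff_le (U := U') (C := C) (C' := C') hH
  have hCh := hH.holes_nonneg C'
  set P := (A \ C ∩ U') \ (C' + H) with hP
  set Q := (B \ C ∩ U') \ (C' + H) with hQ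
  have hPA : P ⊆ A \ C := sdiff_subset.trans inter_subset_left
  have hQB : Q ⊆ B \ C := sdiff_subset.trans inter_subset_left
  have hPQ : P ∪ Q = (U' \ C) \ (C' + H) := by
    rw [hP, hQ, ← union_sdiff_distrib, ← union_inter_distrib_right, hWU]
    congr 1
    ext x
    have := @hst.subset_left x
    simp only [mem_inter, mem_sdiff]
    tauto
  have hPQsum : truncSum (t - (#(U \ U') + #(C \ C'))) P Q (U' + C') ≤
      ∑ g ∈ (A + B) \ (U' + C'), min (t - (#(U \ U') + #(C \ C'))) (rep (A \ C) (B \ C) g) := by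
    rw [truncSum_eq (add_subset_add (hPA.trans sdiff_subset) (hQB.trans sdiff_subset) :
      _ ⊆ A + B)]
    exact sum_le_sum fun g _ => min_le_min le_rfl (rep_mono hPA hQB g)
  have state : DescentState t A B H (U' + C') P Q (t - (#(U \ U') + #(C \ C'))) := by
    refine ⟨by omega, by omega, hH, hper, hle_rep, hPA.trans sdiff_subset,
      hQB.trans sdiff_subset, ?_, ?_⟩
    -- The l discarded elements may belong to both A and B, whence the allowance 2(t − s) = 2l.
    · refine ⟨A \ (U \ U' ∪ C \ C'), sdiff_subset, B \ (U \ U' ∪ C \ C'), sdiff_subset, ?_, ?_⟩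
      · have h1 := card_union_le (U \ U') (C \ C')
        have h2 := card_sdiff_sdiff_le A A (U \ U' ∪ C \ C')
        have h3 := card_sdiff_sdiff_le B B (U \ U' ∪ C \ C')
        rw [sdiff_self, bot_eq_empty, card_empty] at h2 h3
        omega
      · intro a ha b hb hab
        simp only [mem_sdiff, mem_union, not_or, not_and, not_not] at ha hb
        have haU : a ∈ U' := ha.2.1 (hAU ha.1)
        have hbU : b ∈ U' := hb.2.1 (hBU hb.1)
        have ha' : a ∉ C' + H := fun h => hab (hD a haU h b hbU)
        have hb' : b ∉ C' + H := fun h => hab (by rw [add_comm a]; exact hD b hbU h a haU)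
        have haC : a ∉ C := fun h => ha' (hH.subset_add C' (ha.2.2 h))
        have hbC : b ∉ C := fun h => hb' (hH.subset_add C' (hb.2.2 h))
        simp only [hP, hQ, mem_sdiff, mem_inter]
        tauto
    · rw [hPQ, Nat.cast_sub hlt.le]
      zify at hPQsum
      push_cast at hlow
      have h1 := (add_le_add_right hPQsum _).trans hlow
      have hl0 : (0 : ℤ) ≤ (#(U \ U') + #(C \ C') : ℕ) := Int.natCast_nonneg _
      have hl1 : (#(C \ C') : ℤ) ≤ (#(U \ U') + #(C \ C') : ℕ) := by omega
      have hUC'' : (#U' + #C' : ℤ) = #U + #C - (#(U \ U') + #(C \ C') : ℕ) := by omega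
      rw [← Nat.cast_add] at h1
      have hlt' : ((#(U \ U') + #(C \ C') : ℕ) : ℤ) < t := by exact_mod_cast hlt
      generalize (#(U \ U') + #(C \ C') : ℕ) = l at *
      generalize holes H ((U' \ C) \ (C' + H)) = σ at *
      rw [hUC''] at hkn
      have h2 : (t : ℤ) * (#U + #C - l + (holes H U' + holes H C')) ≤
          t * (#(U' + C') + #H) := by gcongr
      have h3 : ((t : ℤ) - l) * σ ≤ (t - l) * (holes H U' + holes H C' + l) :=
        mul_le_mul_of_nonneg_left (by omega) (by omega)
      nlinarith
  refine DescentState.hasPopularCore _ le_rfl state fun s X Y hs hX hY hYQ hXY =>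
    ih s X Y hs hX hY ?_ hXY
  have := card_le_card hQB
  omega

theorem hasPopularCore_vadd {t : ℕ} {A B : Finset G} (x : G)
    (h : HasPopularCore t A (x +ᵥ B)) : HasPopularCore t A B := by
  obtain ⟨A₀, hA₀, B₀, hB₀, hlt, hrep⟩ := h
  have hB₀' : -x +ᵥ B₀ ⊆ B := by
    rw [← neg_vadd_vadd x B]
    exact vadd_finset_subset_vadd_finset hB₀
  refine ⟨A₀, hA₀, -x +ᵥ B₀, hB₀', ?_, ?_⟩
  · have h1 := card_sdiff_add_card_eq_card hB₀
    have h2 := card_sdiff_add_card_eq_card hB₀'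
    have h3 : #(-x +ᵥ B₀) = #B₀ := card_vadd_finset _ _
    have h4 : #(x +ᵥ B) = #B := card_vadd_finset _ _
    omega
  · intro a ha b hb
    obtain ⟨b', hb', rfl⟩ := mem_vadd_finset.1 hb
    have := hrep a ha b' hb'
    rw [rep_vadd_right] at this
    convert this using 2
    rw [vadd_eq_add]; abel

theorem hasPopularCore_of_truncSum_le (n : ℕ) : ∀ (t : ℕ) (A B : Finset G), #B ≤ n → 1 ≤ t →
    t ≤ #A → t ≤ #B → (truncSum t A B ∅ : ℤ) ≤ t * (#A + #B) - 2 * t ^ 2 →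
    HasPopularCore t A B := by
  induction n with
  | zero => intro t A B hn ht hA hB; omega
  | succ n ihn =>
    intro t A B hn ht hA hB hN
    have ih : ∀ (s : ℕ) (X Y : Finset G), 1 ≤ s → s ≤ #X → s ≤ #Y → #Y < #B →
        (truncSum s X Y ∅ : ℤ) ≤ s * (#X + #Y) - 2 * s ^ 2 →
        ∃ X' Y', Structured s X Y X' Y' := by
      intro s X Y hs hX hY hYB hXY
      obtain ⟨X₀, hX₀, Y₀, hY₀, hlt, hrep⟩ := ihn s X Y (by omega) hs hX hY hXY
      exact exists_structured hs hX hY hXY hX₀ hY₀ hlt hrep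
    by_cases hall : ∀ a ∈ A, ∀ b ∈ B, (a - b) +ᵥ B ⊆ A
    -- In this case a + b − b' lies in A for every b' in B, so each sum has |B| ≥ t representations.
    · refine ⟨A, le_rfl, B, le_rfl, by simp; omega, fun a ha b hb => ?_⟩
      rw [rep_comm, rep, filter_true_of_mem]
      · exact hB
      · intro b' hb'
        have := hall a ha b' hb' (vadd_mem_vadd_finset hb)
        convert this using 1
        rw [vadd_eq_add]; abel
    push Not at hall
    obtain ⟨a, ha, b, hb, hab⟩ := hall
    apply hasPopularCore_vadd (a - b)
    have hBc : #((a - b) +ᵥ B) = #B := card_vadd_finset _ _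
    have haB : a ∈ (a - b) +ᵥ B := by
      have := vadd_mem_vadd_finset (a := a - b) hb
      simpa using this
    rw [← truncSum_vadd t A B (a - b), ← hBc] at hN
    rw [← hBc] at ih hB
    generalize (a - b) +ᵥ B = B' at *
    have hc : 1 ≤ #(A ∩ B') := card_pos.2 ⟨a, mem_inter.2 ⟨ha, haB⟩⟩
    rcases lt_or_ge #(A ∩ B') t with hct | hct
    · exact hasPopularCore_of_small_inter hA hB hN ih hc hct
    · refine hasPopularCore_of_large_inter ht hN ih hct (card_lt_card ?_)
      exact ⟨inter_subset_right, fun h => hab fun x hx => (mem_inter.1 (h hx)).1⟩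

theorem sum_card_repSums (t : ℕ) (A B : Finset G) :
    ∑ i ∈ Icc 1 t, #(repSums A B i) = truncSum t A B ∅ := by
  rw [truncSum_empty_eq (le_refl (A + B))]
  simp_rw [repSums, card_filter]
  rw [sum_comm]
  refine sum_congr rfl fun g _ => ?_
  rw [← card_filter, addConvolution_eq_rep]
  have : {i ∈ Icc 1 t | i ≤ rep A B g} = Icc 1 (min t (rep A B g)) := by
    ext i; simp only [mem_filter, mem_Icc, le_min_iff]; tauto
  rw [this, Nat.card_Icc, Nat.add_sub_cancel]

theorem coe_stabilizer_eq_finStab {D : Finset G} (hD : D.Nonempty) :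
    (AddAction.stabilizer G D : Set G) = (finStab D : Set G) := by
  ext x
  rw [SetLike.mem_coe, AddAction.mem_stabilizer_iff, mem_coe, mem_finStab hD]

/-- A representation of a sum off A' + B' must use one of the fewer than t removed elements, so
there are fewer than t of them. -/
theorem Structured.repSums_eq {t : ℕ} {A B A' B' : Finset G} (ht : 1 ≤ t)
    (h : Structured t A B A' B') : repSums A B t = A' + B' := by
  ext g
  rw [mem_repSums A B ht, addConvolution_eq_rep]
  constructor
  · intro hg
    by_contra hcon
    have h1 := rep_sdiff_left h.subset_left B g
    have h2 := rep_sdiff_right A' h.subset_right g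
    have h3 := rep_mono (le_refl (A \ A')) (le_refl B) g
    have h4 := rep_le_card_left (A \ A') B g
    have h5 := rep_le_card_right A' (B \ B') g
    have h6 := rep_eq_zero hcon
    have h7 := h.lt
    omega
  · intro hg
    have h1 := h.two_mul_le_rep hg
    have h2 := rep_mono h.subset_left h.subset_right g
    omega

theorem Structured.repSums_eq_self {t : ℕ} {A B A' B' : Finset G} (ht : 1 ≤ t)
    (h : Structured t A B A' B') : repSums A' B' t = A' + B' := by
  ext g
  rw [mem_repSums A' B' ht, addConvolution_eq_rep]
  constructor
  · intro hg
    by_contra hcon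
    have := rep_eq_zero hcon
    omega
  · intro hg
    have := h.two_mul_le_rep hg
    omega

theorem holeCount_eq_holes {K : AddSubgroup G} {H : Finset G} (hK : (K : Set G) = H)
    (A : Finset G) : holeCount K A = holes H A := by
  rw [holeCount, holes, hK, ← coe_add, Set.ncard_coe_finset]

end Main

theorem theorem1 {G : Type*} [AddCommGroup G] [DecidableEq G] (t : ℕ) (ht : 1 ≤ t)
    (A B : Finset G) (hA : t ≤ A.card) (hB : t ≤ B.card) :
    (t * A.card + t * B.card - 2 * t ^ 2 + 1 : ℤ) ≤
        ∑ i ∈ Finset.Icc 1 t, ((repSums A B i).card : ℤ) ∨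
      ∃ A' B' : Finset G, A' ⊆ A ∧ B' ⊆ B ∧
        let l : ℤ := (A \ A').card + (B \ B').card
        let H : AddSubgroup G := AddAction.stabilizer G (repSums A B t)
        let ρ : ℤ := holeCount H A' + holeCount H B'
        l ≤ t - 1 ∧
        repSums A' B' t = A' + B' ∧
        A' + B' = repSums A B t ∧
        H ≠ ⊥ ∧
        Finite H ∧
        (t * A.card + t * B.card - (t - l) * (Nat.card H - ρ) - t * l : ℤ) ≤
          ∑ i ∈ Finset.Icc 1 t, ((repSums A B i).card : ℤ) ∧
        (t * A.card + t * B.card - t * Nat.card H : ℤ) ≤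
          t * A.card + t * B.card - (t - l) * (Nat.card H - ρ) - t * l := by
  rw [← Nat.cast_sum, sum_card_repSums]
  by_cases hN : (t * #A + t * #B - 2 * t ^ 2 + 1 : ℤ) ≤ truncSum t A B ∅
  · exact Or.inl hN
  right
  have hN' : (truncSum t A B ∅ : ℤ) ≤ t * (#A + #B) - 2 * t ^ 2 := by rw [mul_add]; omega
  obtain ⟨A₀, hA₀, B₀, hB₀, hlt₀, hrep⟩ :=
    hasPopularCore_of_truncSum_le _ t A B le_rfl ht hA hB hN'
  obtain ⟨A', B', h⟩ := exists_structured ht hA hB hN' hA₀ hB₀ hlt₀ hrep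
  have hne := h.nonempty_left.add h.nonempty_right
  have hH := coe_stabilizer_eq_finStab hne
  have hcard : Nat.card (AddAction.stabilizer G (A' + B')) = #(finStab (A' + B')) := by
    rw [← SetLike.coe_sort_coe, hH, Nat.card_coe_set_eq, Set.ncard_coe_finset]
  refine ⟨A', B', h.subset_left, h.subset_right, ?_⟩
  rw [h.repSums_eq ht, h.repSums_eq_self ht]
  simp only [holeCount_eq_holes hH, hcard]
  have hlow := h.le_truncSum
  have hkn := h.card_add_card_add_holes_le
  have h2t := h.two_mul_le
  have hlt := h.lt
  have hA'c := card_sdiff_add_card_eq_card h.subset_left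
  have hB'c := card_sdiff_add_card_eq_card h.subset_right
  have hρ : 0 ≤ holes (finStab (A' + B')) A' + holes (finStab (A' + B')) B' :=
    add_nonneg (h.isFinSubgroup.holes_nonneg _) (h.isFinSubgroup.holes_nonneg _)
  refine ⟨by omega, trivial, trivial, ?_, ?_, ?_, ?_⟩
  -- The stabilizer has at least 2t ≥ 2 elements.
  · intro hbot
    rw [hbot, AddSubgroup.card_bot] at hcard
    omega
  · rw [← SetLike.coe_sort_coe, hH]
    exact Finite.of_fintype _
  · have hA'c' : (#A : ℤ) = #(A \ A') + #A' := by omega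
    have hB'c' : (#B : ℤ) = #(B \ B') + #B' := by omega
    rw [hA'c', hB'c']
    push_cast at hlow
    nlinarith [mul_le_mul_of_nonneg_left hkn (Int.natCast_nonneg t)]
  · have hl0 : (0 : ℤ) ≤ #(A \ A') + #(B \ B') := by positivity
    have hl1 : (#(A \ A') + #(B \ B') : ℤ) ≤ t := by omega
    have h3 := mul_nonneg (sub_nonneg.2 hl1) hρ
    have h4 : (#(A \ A') + #(B \ B') : ℤ) * t ≤
        (#(A \ A') + #(B \ B')) * #(finStab (A' + B')) :=
      mul_le_mul_of_nonneg_left (by omega) hl0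
    nlinarith
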